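/- **Setting.** Let $d\in\{2,3\}$, let $\Omega\subset\mathbb R^d$ be a Lipschitz domain with boundary $\Gamma$, and let $\mathcal T_h$ be a finite mesh of $\Omega$: pairwise disjoint bounded open Lipschitz elements $K\subset\Omega$ with $\bigcup_K\overline K=\overline\Omega$ and $|\partial K|<\infty$, such that triple intersections of element boundaries, and the sets $\partial K\cap\partial K'\cap\Gamma$ ($K\ne K'$), have zero surface measure (hanging nodes are allowed). Let $n_K$ be the outward unit normal of $K$. The interior faces are the sets $\Lambda=\partial K_1\cap\partial K_2$, $K_1\neq K_2$, with $|\Lambda|>0$; each has a fixed normal $n_\Lambda$ directed from $K_1$ to $K_2$. Write $[v]=v|_{K_1}-v|_{K_2}$ and $\{v\}=\frac12(v|_{K_1}+v|_{K_2})$ for one-sided traces, and $[v]=\{v\}=v$ on faces in $\Gamma$. Let $A(x)$ be a symmetric positive semidefinite matrix, Lipschitz on each element (on $\partial K$ its values are taken from inside $K$); let $u\in H(\mathrm{div};\Omega)$ with $u\cdot n_K\in L^1(\partial K)$ for every $K$; let $\gamma$ be a function, $g\in L^2(\Omega)$, and $\gamma_0=\gamma+\frac12\operatorname{div}u$. Up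 to null sets, $\Gamma_{\rm df}=\{x\in\Gamma:n^\top An>0\}$ is the disjoint union of measurable sets $\Gamma_{{\rm df},D}$ and $\Gamma_{{\rm df},N}$. Put $\Gamma_{\rm ad}=\{x\in\Gamma:n^\top An=0\}$; a subscript $-$ (resp. $+$) denotes the part of a set where $u\cdot n<0$ (resp. $u\cdot n\ge0$). **Exact solution.** Let $\nabla c$ denote the elementwise gradient. Let $c$ satisfy $-A\nabla c+uc\in H(\mathrm{div};\Omega)$ and $\operatorname{div}(-A\nabla c+uc)+\gamma c=g$ a.e. in $\Omega$, with $c=\kappa$ on $\Gamma_{{\rm df},D}\cup\Gamma_{{\rm ad},-}$, $(-A\nabla c+uc)\cdot n=\chi^-$ on $\Gamma_{{\rm df},N,-}$ and $-A\nabla c\cdot n=\chi^+$ on $\Gamma_{{\rm df},N,+}$, in the sense of traces. Assume that $c$ has, on every element $K$, the regularity which the scheme presupposes: $c|_K\in H^1(K)$; $c|_K$ has a trace in $L^2(\partial K)$; $(u\cdot n_K)\,c|_K\in L^1(\partial K)$; and $A\nabla c$ has a normal trace $(A\nabla c)\cdot n_K=(AG)\cdot n_K$ on $\partial K$, where $G\in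 L^2(\partial K)^d$ is the limit in $L^2(\partial K)$ of the boundary values of smooth fields $F_k$ with $F_k\to\nabla c$ in $L^2(K)$ and $\operatorname{div}(AF_k)\to\operatorname{div}(A\nabla c)$ in $L^1(K)$. **Faces.** Assume that every interior face is (with all conditions a.e. on the face) of one of four kinds: *diffusion–diffusion*, $\mathcal F^{\rm df\text{-}df,0}_h$, if $n^\top An>0$ on both sides; *advection–advection*, $\mathcal F^{\rm ad\text{-}ad,0}_h$, if $n^\top An=0$ on both sides; *inflow*, resp. *outflow*, *advection–diffusion*, $\mathcal F^{\rm ad\text{-}df,0,-}_h$, resp. $\mathcal F^{\rm ad\text{-}df,0,+}_h$, if $n^\top An>0$ on one side and $n^\top An=0$ on the other side, and $u\cdot n<0$, resp. $u\cdot n\ge 0$, for the normal $n$ which points **from the side with diffusion to the side without**. Let $\mathcal F_{{\rm df},D,h}$ be the set of all $\Lambda=\partial K\cap\Gamma_{{\rm df},D}$ with $|\Lambda|>0$. Let $A_{\max,K}$ and $A_{\max,\Lambda,\partial K}$ be the least constants $a\ge0$ with $\xi^\top A\xi\le a|\xi|^2$ for all $\xi$, a.e. on $K$, resp. a.e. on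 $\Lambda$ with $A$ taken from $K$. Put $A_\Lambda=\frac12(A_{\max,\Lambda,\partial K_1}+A_{\max,\Lambda,\partial K_2})$ on interior faces and $A_\Lambda=A_{\max,\Lambda,\partial K}$ on $\mathcal F_{{\rm df},D,h}$. Let $\mathcal F^{\rm df\text{-}df\text{-}dfd,0}_h$ and $\mathcal F_{{\rm df\text{-}dfd},D,h}$ consist of the faces of $\mathcal F^{\rm df\text{-}df,0}_h$ and $\mathcal F_{{\rm df},D,h}$ with $|\Lambda|^{1/(d-1)}|u\cdot n|<A_\Lambda$ a.e. on $\Lambda$. **Scheme.** Let $\ell\ge1$, $\alpha>0$, $U_h=\{v:v|_K\in P_\ell(K)\ \forall K\}$. Let $\varepsilon_K$ be the maximum of $A_{\max,K}$ and of the $A_\Lambda$ with $\Lambda\in\mathcal F^{\rm df\text{-}df,0}_h\cup\mathcal F_{{\rm df},D,h}$, $\Lambda\subset\partial K$, and with $h_K=\operatorname{diam}K$ let $$\tau_K=\frac{\alpha h_K^2}{\varepsilon_K+h_K|u|+h_K^2|\operatorname{div}u|+h_K^2|\gamma_0|}$$ (with the value $0$ where the denominator vanishes). Put $B_K w=\frac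 u2\cdot\nabla w+\frac12\operatorname{div}(uw)$ on $K$ and $\partial_-K=\{x\in\partial K:u\cdot n_K<0\}$. On $\partial_-K$ write $[c]=c|_K-c|_{K'}$ on the faces shared with $K'$, and $[c]=c$ on $\Gamma$. Define $$\begin{aligned}L^S_{{\rm dfd},h}(c,v)={}&\sum_K(A\nabla c,\nabla v)_K-\sum_{\Lambda\in\mathcal F^{\rm df\text{-}df,0}_h\cup\mathcal F_{{\rm df},D,h}}\big(\langle\{A\nabla c\cdot n_\Lambda\},[v]\rangle_\Lambda-\langle\{A\nabla v\cdot n_\Lambda\},[c]\rangle_\Lambda\big)\\&+\sum_{\Lambda\in\mathcal F^{\rm df\text{-}df\text{-}dfd,0}_h\cup\mathcal F_{{\rm df\text{-}dfd},D,h}}|\Lambda|^{-\frac1{d-1}}A_\Lambda\langle[c],[v]\rangle_\Lambda+\sum_K(B_Kc,v)_K-\sum_K\langle v,u\cdot n_K[c]\rangle_{\partial_-K}\\&+\sum_K(\gamma_0c,v)_K+\sum_K\big(-\operatorname{div}(A\nabla c)+B_Kc+\gamma_0c,\ \tau_K(B_Kv-\gamma_0v)\big)_K,\end{aligned}$$ $$\begin{aligned}R^T_h(v)={}&(g,v)_\Omega+\sum_{\Lambda\in\mathcal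 F_{{\rm df},D,h}}\langle A\nabla v\cdot n,\kappa\rangle_\Lambda+\sum_{\Lambda\in\mathcal F_{{\rm df\text{-}dfd},D,h}}|\Lambda|^{-\frac1{d-1}}A_\Lambda\langle\kappa,v\rangle_\Lambda-\langle v,u\cdot n\,\kappa\rangle_{\Gamma_{{\rm ad},-}\cup\Gamma_{{\rm df},D,-}}\\&-\langle v,\chi^-\rangle_{\Gamma_{{\rm df},N,-}}-\langle v,\chi^+\rangle_{\Gamma_{{\rm df},N,+}}+\sum_K\big(g,\tau_K(B_Kv-\gamma_0v)\big)_K.\end{aligned}$$ **Theorem 3.1.** Assume in addition that $[c]=0$ a.e. on every face of $\mathcal F^{\rm df\text{-}df,0}_h$, that $u\cdot n[c]=0$ a.e. on every face of $\mathcal F^{\rm ad\text{-}df,0,+}_h$, and that $u\cdot n[c]=0$ a.e. on every face of $\mathcal F^{\rm ad\text{-}ad,0}_h$ (nothing is assumed about $[c]$ on $\mathcal F^{\rm ad\text{-}df,0,-}_h$). Then $$L^S_{{\rm dfd},h}(c,v_h)=R^T_h(v_h)\qquad\text{for all }v_h\in U_h.$$ -/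

import Mathlib

open MeasureTheory Set Filter Topology
open scoped ContDiff ENNReal RealInnerProductSpace

noncomputable section

namespace AdvDiffDG

/-- Points (and vectors) of `ℝ^d` with the Euclidean norm. -/
abbrev Pt (d : ℕ) : Type := EuclideanSpace ℝ (Fin d)

/-! ### Weak derivatives, `H¹`, `H(div)` -/

/-- Smooth compactly supported functions on `ℝ^d`. -/
def IsTest {d : ℕ} (φ : Pt d → ℝ) : Prop :=
  ContDiff ℝ ∞ φ ∧ HasCompactSupport φ

/-- `w` is the weak gradient of `f` on the open set `U`. -/
def HasWeakGrad {d : ℕ} (U : Set (Pt d)) (f : Pt d → ℝ) (w : Pt d → Pt d) : Prop :=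
  LocallyIntegrableOn f U ∧ LocallyIntegrableOn w U ∧
    ∀ φ : Pt d → ℝ, IsTest φ → tsupport φ ⊆ U →
      ∫ x in U, f x • gradient φ x = - ∫ x in U, φ x • w x

/-- `δ` is the weak divergence of `σ` on the open set `U`. -/
def HasWeakDiv {d : ℕ} (U : Set (Pt d)) (σ : Pt d → Pt d) (δ : Pt d → ℝ) : Prop :=
  LocallyIntegrableOn σ U ∧ LocallyIntegrableOn δ U ∧
    ∀ φ : Pt d → ℝ, IsTest φ → tsupport φ ⊆ U →
      ∫ x in U, ⟪σ x, gradient φ x⟫ = - ∫ x in U, δ x * φ x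

open Classical in
/-- The weak gradient (determined almost everywhere on `U`; zero if there is none). -/
def weakGrad {d : ℕ} (U : Set (Pt d)) (f : Pt d → ℝ) : Pt d → Pt d :=
  if h : ∃ w, HasWeakGrad U f w then h.choose else 0

open Classical in
/-- The weak divergence (determined almost everywhere on `U`; zero if there is none). -/
def weakDiv {d : ℕ} (U : Set (Pt d)) (σ : Pt d → Pt d) : Pt d → ℝ :=
  if h : ∃ δ, HasWeakDiv U σ δ then h.choose else 0

/-- `f ∈ H¹(U)`. -/
def MemH1 {d : ℕ} (U : Set (Pt d)) (f : Pt d → ℝ) : Prop :=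
  MemLp f 2 (volume.restrict U) ∧
    ∃ w, HasWeakGrad U f w ∧ MemLp w 2 (volume.restrict U)

/-- `σ ∈ H(div; U)`. -/
def MemHdiv {d : ℕ} (U : Set (Pt d)) (σ : Pt d → Pt d) : Prop :=
  MemLp σ 2 (volume.restrict U) ∧
    ∃ δ, HasWeakDiv U σ δ ∧ MemLp δ 2 (volume.restrict U)

/-! ### Lipschitz domains, surface measure, outward normal -/

/-- An open set which near each of its boundary points is, in suitable orthogonal coordinates,
the region strictly below the graph of a Lipschitz function. Here `ν` is the vertical direction
and `f`, being invariant in the direction `ν`, is a function of the horizontal variables only. -/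
def IsLipschitzDomain {d : ℕ} (U : Set (Pt d)) : Prop :=
  IsOpen U ∧ ∀ x ∈ frontier U, ∃ (ν : Pt d) (r : ℝ) (C : NNReal) (f : Pt d → ℝ),
    ‖ν‖ = 1 ∧ 0 < r ∧ LipschitzWith C f ∧ (∀ (y : Pt d) (t : ℝ), f (y + t • ν) = f y) ∧
      ∀ y ∈ Metric.ball x r, (y ∈ U ↔ ⟪ν, y⟫ < f y)

/-- The `(d-1)`-dimensional surface measure of `ℝ^d` (Hausdorff measure, normalised so as to be
Euclidean area on hyperplanes). -/
def surf (d : ℕ) : Measure (Pt d) :=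
  MeasureTheory.Measure.euclideanHausdorffMeasure (d - 1)

/-- The surface measure on the boundary of `K`. -/
def bdry {d : ℕ} (K : Set (Pt d)) : Measure (Pt d) :=
  (surf d).restrict (frontier K)

/-- `n` is the outward unit normal of `K`: the unit field on `∂K` such that the distributional
gradient of the indicator function of `K` is `-n` times the surface measure on `∂K` (De Giorgi's
definition of the exterior normal). It is determined almost everywhere on `∂K`; on a Lipschitz
domain it is the geometric normal. -/
def IsOutwardNormal {d : ℕ} (K : Set (Pt d)) (n : Pt d → Pt d) : Prop :=
  AEStronglyMeasurable n (bdry K) ∧ (∀ᵐ x ∂(bdry K), ‖n x‖ = 1) ∧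
    ∀ φ : Pt d → ℝ, IsTest φ → ∫ x in K, gradient φ x = ∫ x, φ x • n x ∂(bdry K)

/-! ### Traces -/

/-- `q ∈ L²(∂K)` is the trace of `f ∈ H¹(K)`: the limit of the boundary values of smooth functions
which converge to `f` in `H¹(K)`. -/
def IsTrace {d : ℕ} (K : Set (Pt d)) (f : Pt d → ℝ) (q : Pt d → ℝ) : Prop :=
  MemLp q 2 (bdry K) ∧
    ∃ ψ : ℕ → Pt d → ℝ, (∀ k, ContDiff ℝ ∞ (ψ k)) ∧
      Tendsto (fun k => eLpNorm (fun x => ψ k x - f x) 2 (volume.restrict K)) atTop (𝓝 0) ∧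
      Tendsto (fun k => eLpNorm (fun x => gradient (ψ k) x - weakGrad K f x) 2
        (volume.restrict K)) atTop (𝓝 0) ∧
      Tendsto (fun k => eLpNorm (fun x => ψ k x - q x) 2 (bdry K)) atTop (𝓝 0)

open Classical in
/-- The trace `f|_K` on `∂K`. -/
def trace {d : ℕ} (K : Set (Pt d)) (f : Pt d → ℝ) : Pt d → ℝ :=
  if h : ∃ q, IsTrace K f q then h.choose else 0

/-- The normal trace `σ·n` on `∂K` of a field with integrable divergence is the function `q` in
`L¹(∂K)`. As usual for `H(div; K)`, the normal trace is the functional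
`φ ↦ ∫_K (σ·∇φ + (div σ) φ)` of the boundary values of `φ`. -/
def IsNormalTrace {d : ℕ} (K : Set (Pt d)) (σ : Pt d → Pt d) (q : Pt d → ℝ) : Prop :=
  Integrable q (bdry K) ∧
    ∃ δ, HasWeakDiv K σ δ ∧ IntegrableOn δ K ∧
      ∀ φ : Pt d → ℝ, IsTest φ →
        ∫ x in K, (⟪σ x, gradient φ x⟫ + δ x * φ x) = ∫ x, q x * φ x ∂(bdry K)

open Classical in
/-- The normal trace `σ·n` on `∂K`, `n` the outward normal of `K`. -/
def normalTrace {d : ℕ} (K : Set (Pt d)) (σ : Pt d → Pt d) : Pt d → ℝ :=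
  if h : ∃ q, IsNormalTrace K σ q then h.choose else 0

/-- The values of the coefficient `A` on the boundary of `K`, taken from inside `K`. -/
def sided {d : ℕ} (K : Set (Pt d)) (A : Pt d → (Pt d →L[ℝ] Pt d)) :
    Pt d → (Pt d →L[ℝ] Pt d) :=
  extendFrom K A

/-- The diffusive normal flux `q = (A∇f)·n` on `∂K`: there are smooth fields `F k` with
`F k → ∇f` in `L²(K)` and `div (A F k) → div (A∇f)` in `L¹(K)`, whose boundary values converge in
`L²(∂K)`, say to `G`, and `q = (A G)·n`, with the values of `A` taken from inside `K`. -/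
def IsConormalTrace {d : ℕ} (K : Set (Pt d)) (n : Pt d → Pt d)
    (A : Pt d → (Pt d →L[ℝ] Pt d)) (f : Pt d → ℝ) (q : Pt d → ℝ) : Prop :=
  ∃ (F : ℕ → Pt d → Pt d) (G : Pt d → Pt d) (ε : ℕ → Pt d → ℝ) (δ : Pt d → ℝ),
    (∀ k, ContDiff ℝ ∞ (F k)) ∧ MemLp G 2 (bdry K) ∧
    (∀ k, HasWeakDiv K (fun x => A x (F k x)) (ε k) ∧ IntegrableOn (ε k) K) ∧
    HasWeakDiv K (fun x => A x (weakGrad K f x)) δ ∧ IntegrableOn δ K ∧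
    Tendsto (fun k => eLpNorm (fun x => F k x - weakGrad K f x) 2 (volume.restrict K))
      atTop (𝓝 0) ∧
    Tendsto (fun k => eLpNorm (fun x => ε k x - δ x) 1 (volume.restrict K)) atTop (𝓝 0) ∧
    Tendsto (fun k => eLpNorm (fun x => F k x - G x) 2 (bdry K)) atTop (𝓝 0) ∧
    q =ᵐ[bdry K] fun x => ⟪n x, sided K A x (G x)⟫

open Classical in
/-- The diffusive normal flux `(A∇f)·n` on `∂K`. -/
def conormalTrace {d : ℕ} (K : Set (Pt d)) (n : Pt d → Pt d)
    (A : Pt d → (Pt d →L[ℝ] Pt d)) (f : Pt d → ℝ) : Pt d → ℝ :=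
  if h : ∃ q, IsConormalTrace K n A f q then h.choose else 0

/-! ### Data of the boundary value problem and mesh -/

/-- The data of the problem `div(-A∇c + uc) + γc = g` in `Ω`, `c = κ` on the Dirichlet boundary,
with Neumann data `χm` (inflow, total flux) and `χp` (outflow, diffusive flux). `ΓdfD` and `ΓdfN`
are the Dirichlet and the Neumann part of the diffusion boundary. The diffusion matrix is given as
a linear map of `ℝ^d`. -/
structure Problem (d : ℕ) where
  Ω : Set (Pt d)
  A : Pt d → (Pt d →L[ℝ] Pt d)
  u : Pt d → Pt d
  γ : Pt d → ℝ
  g : Pt d → ℝ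
  κ : Pt d → ℝ
  χm : Pt d → ℝ
  χp : Pt d → ℝ
  ΓdfD : Set (Pt d)
  ΓdfN : Set (Pt d)

/-- A mesh of `Ω`: finitely many disjoint bounded open Lipschitz elements whose closures cover the
closure of `Ω`, with an orientation of the interior faces. Neither shape regularity nor conformity
is required. The intersections of element boundaries with each other and with `∂Ω` overlap only in
sets of surface measure zero. -/
structure Mesh {d : ℕ} (Ω : Set (Pt d)) (ι : Type*) where
  elem : ι → Set (Pt d)
  nonempty : ∀ i, (elem i).Nonempty
  bounded : ∀ i, Bornology.IsBounded (elem i)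
  lipschitz : ∀ i, IsLipschitzDomain (elem i)
  subset : ∀ i, elem i ⊆ Ω
  disjoint : ∀ i j, i ≠ j → Disjoint (elem i) (elem j)
  cover : ⋃ i, closure (elem i) = closure Ω
  finite_boundary : ∀ i, surf d (frontier (elem i)) < (⊤ : ℝ≥0∞)
  overlap : ∀ i j k, i ≠ j → i ≠ k → j ≠ k →
    surf d (frontier (elem i) ∩ frontier (elem j) ∩ frontier (elem k)) = 0
  overlap_boundary : ∀ i j, i ≠ j →
    surf d (frontier (elem i) ∩ frontier (elem j) ∩ frontier Ω) = 0
  /-- the outward unit normal of each element -/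
  normal : ι → Pt d → Pt d
  isOutwardNormal : ∀ i, IsOutwardNormal (elem i) (normal i)
  /-- the interior faces: `(i, j)` stands for `∂K_i ∩ ∂K_j`, with normal from `K_i` to `K_j` -/
  faces : Finset (ι × ι)
  mem_faces : ∀ i j, ((i, j) ∈ faces ∨ (j, i) ∈ faces) ↔
    (i ≠ j ∧ 0 < surf d (frontier (elem i) ∩ frontier (elem j)))
  oriented : ∀ i j, (i, j) ∈ faces → (j, i) ∉ faces

section Scheme

variable {d : ℕ} {ι : Type*} [Fintype ι] (P : Problem d) (M : Mesh P.Ω ι)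

/-- The intersection of the boundaries of two elements. -/
def face (i j : ι) : Set (Pt d) := frontier (M.elem i) ∩ frontier (M.elem j)

/-- The part of an element boundary on `Γ = ∂Ω`. -/
def bface (i : ι) : Set (Pt d) := frontier (M.elem i) ∩ frontier P.Ω

/-- `n^T A n` on the boundary of the `i`-th element, from inside. -/
def nAn (i : ι) (x : Pt d) : ℝ :=
  ⟪M.normal i x, sided (M.elem i) P.A x (M.normal i x)⟫

/-- `u·n` on the boundary of the `i`-th element, `n` the outward normal of this element. -/
def un (i : ι) : Pt d → ℝ := normalTrace (M.elem i) P.u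

/-- The one-sided trace of `c` from the `i`-th element. -/
def tr (c : Pt d → ℝ) (i : ι) : Pt d → ℝ := trace (M.elem i) c

/-- `(A∇c)·n` on the boundary of the `i`-th element, with its own outward normal. -/
def cn (c : Pt d → ℝ) (i : ι) : Pt d → ℝ :=
  conormalTrace (M.elem i) (M.normal i) P.A c

/-! Subsets of the interior faces. -/

/-- `n^T A n > 0` almost everywhere on `∂K_i ∩ ∂K_j`, on the side of `K_i`. -/
def DiffSide (i j : ι) : Prop := ∀ᵐ x ∂((surf d).restrict (face P M i j)), 0 < nAn P M i x

/-- `n^T A n = 0` almost everywhere on `∂K_i ∩ ∂K_j`, on the side of `K_i`. -/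
def AdvSide (i j : ι) : Prop := ∀ᵐ x ∂((surf d).restrict (face P M i j)), nAn P M i x = 0

/-- diffusion-diffusion face -/
def IsDfDf (i j : ι) : Prop := DiffSide P M i j ∧ DiffSide P M j i

/-- advection-advection face -/
def IsAdAd (i j : ι) : Prop := AdvSide P M i j ∧ AdvSide P M j i

/-- inflow advection-diffusion face: `K_i` is on the side with diffusion, `K_j` on the side
without, and `u·n < 0` for the normal `n` outward to `K_i` -/
def IsAdDfIn (i j : ι) : Prop := DiffSide P M i j ∧ AdvSide P M j i ∧
  ∀ᵐ x ∂((surf d).restrict (face P M i j)), un P M i x < 0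

/-- outflow advection-diffusion face: `K_i` is on the side with diffusion, `K_j` on the side
without, and `u·n ≥ 0` for the normal `n` outward to `K_i` -/
def IsAdDfOut (i j : ι) : Prop := DiffSide P M i j ∧ AdvSide P M j i ∧
  ∀ᵐ x ∂((surf d).restrict (face P M i j)), 0 ≤ un P M i x

/-- Each interior face is of one of the four kinds. -/
def FacesClassified : Prop := ∀ e ∈ M.faces,
  IsDfDf P M e.1 e.2 ∨ (IsAdDfIn P M e.1 e.2 ∨ IsAdDfIn P M e.2 e.1) ∨
    (IsAdDfOut P M e.1 e.2 ∨ IsAdDfOut P M e.2 e.1) ∨ IsAdAd P M e.1 e.2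

open Classical in
/-- The diffusion-diffusion interior faces. -/
def dfdfFaces : Finset (ι × ι) := M.faces.filter fun e => IsDfDf P M e.1 e.2

/-- The Dirichlet diffusion face of the `i`-th element. -/
def dirFace (i : ι) : Set (Pt d) := frontier (M.elem i) ∩ P.ΓdfD

open Classical in
/-- The elements which have a Dirichlet diffusion face. -/
def dirFaces : Finset ι := Finset.univ.filter fun i => 0 < surf d (dirFace P M i)

/-- The least constant `a ≥ 0` with `ξ^T B ξ ≤ a |ξ|²` for all `ξ`, almost everywhere. -/
def maxEig (ν : Measure (Pt d)) (B : Pt d → (Pt d →L[ℝ] Pt d)) : ℝ :=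
  sInf {a : ℝ | 0 ≤ a ∧ ∀ᵐ x ∂ν, ∀ ξ : Pt d, ⟪ξ, B x ξ⟫ ≤ a * ‖ξ‖ ^ 2}

/-- `A_{max,K}` -/
def AmaxElem (i : ι) : ℝ := maxEig (volume.restrict (M.elem i)) P.A

/-- `A_Λ` for an interior face -/
def AFace (e : ι × ι) : ℝ :=
  (maxEig ((surf d).restrict (face P M e.1 e.2)) (sided (M.elem e.1) P.A) +
    maxEig ((surf d).restrict (face P M e.1 e.2)) (sided (M.elem e.2) P.A)) / 2

/-- `A_Λ` for a Dirichlet diffusion face -/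
def ADir (i : ι) : ℝ :=
  maxEig ((surf d).restrict (dirFace P M i)) (sided (M.elem i) P.A)

/-- `|Λ|^{1/(d-1)}` -/
def faceScale (S : Set (Pt d)) : ℝ := (surf d S).toReal ^ (1 / ((d : ℝ) - 1))

open Classical in
/-- The diffusion-dominated diffusion-diffusion faces. -/
def dfdFaces : Finset (ι × ι) := (dfdfFaces P M).filter fun e =>
  ∀ᵐ x ∂((surf d).restrict (face P M e.1 e.2)),
    faceScale (face P M e.1 e.2) * |un P M e.1 x| < AFace P M e

open Classical in
/-- The diffusion-dominated Dirichlet diffusion faces. -/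
def dfdDirFaces : Finset ι := (dirFaces P M).filter fun i =>
  ∀ᵐ x ∂((surf d).restrict (dirFace P M i)),
    faceScale (dirFace P M i) * |un P M i x| < ADir P M i

/-- `ε_{df,K}`, the maximum of `A_{max,K}` and of the `A_Λ` of the faces of `K` with diffusion -/
def epsDf (i : ι) : ℝ :=
  sSup (insert (AmaxElem P M i)
    ({a | ∃ e ∈ dfdfFaces P M, (e.1 = i ∨ e.2 = i) ∧ a = AFace P M e} ∪
      {a | i ∈ dirFaces P M ∧ a = ADir P M i}))

/-- `γ₀ = γ + (div u)/2` -/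
def γ0 (x : Pt d) : ℝ := P.γ x + weakDiv P.Ω P.u x / 2

/-- The stabilizing parameter `τ_K`. -/
def τ (α : ℝ) (i : ι) (x : Pt d) : ℝ :=
  α * Metric.diam (M.elem i) ^ 2 /
    (epsDf P M i + Metric.diam (M.elem i) * ‖P.u x‖
      + Metric.diam (M.elem i) ^ 2 * |weakDiv P.Ω P.u x|
      + Metric.diam (M.elem i) ^ 2 * |γ0 P x|)

/-! ### The finite element space and the forms -/

/-- The value of a polynomial at a point. -/
def pval (p : MvPolynomial (Fin d) ℝ) (x : Pt d) : ℝ := MvPolynomial.eval (fun k => x k) p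

/-- The space `U_h` of discontinuous piecewise polynomials of total degree at most `ℓ`, an element
of which is given by its restrictions to the elements of the mesh. -/
def Uh (d : ℕ) (ι : Type*) (ℓ : ℕ) : Set (ι → MvPolynomial (Fin d) ℝ) :=
  {v | ∀ i, (v i).totalDegree ≤ ℓ}

/-- `(A∇v)·n` on `∂K_i` for a polynomial `v` on `K_i` and a unit vector field `n`. -/
def polyFlux (i : ι) (p : MvPolynomial (Fin d) ℝ) (n : Pt d → Pt d) (x : Pt d) : ℝ :=
  ⟪n x, sided (M.elem i) P.A x (gradient (pval p) x)⟫

/-- `(u/2)·∇c + div(uc)/2` on the `i`-th element. -/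
def advTerm (c : Pt d → ℝ) (i : ι) (x : Pt d) : ℝ :=
  ⟪P.u x, weakGrad (M.elem i) c x⟫ / 2 + weakDiv (M.elem i) (fun y => c y • P.u y) x / 2

/-- `τ_K ((u/2)·∇v + div(uv)/2 - γ₀ v)` on the `i`-th element. -/
def stabTest (α : ℝ) (v : ι → MvPolynomial (Fin d) ℝ) (i : ι) (x : Pt d) : ℝ :=
  τ P M α i x * (advTerm P M (pval (v i)) i x - γ0 P x * pval (v i) x)

/-- The stabilization form `S_h(c, v)`. -/
def Sform (α : ℝ) (c : Pt d → ℝ) (v : ι → MvPolynomial (Fin d) ℝ) : ℝ :=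
  ∑ i, ∫ x in M.elem i,
    (-weakDiv (M.elem i) (fun y => P.A y (weakGrad (M.elem i) c y)) x
      + advTerm P M c i x + γ0 P x * c x) * stabTest P M α v i x

/-- The linear form `T_h(v)`. -/
def Tform (α : ℝ) (v : ι → MvPolynomial (Fin d) ℝ) : ℝ :=
  ∑ i, ∫ x in M.elem i, P.g x * stabTest P M α v i x

open Classical in
/-- `⟨v, u·n [c]⟩` over the inflow boundary `∂₋K_i = {u·n < 0}`. Here `n` is outward to `K_i`, and
`[c]` is the value from `K_i` minus the value from the neighbour, or the value from `K_i` alone on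
`∂Ω`. -/
def inflowTerm (c : Pt d → ℝ) (v : ι → MvPolynomial (Fin d) ℝ) (i : ι) : ℝ :=
  (∑ e ∈ M.faces.filter (fun e => e.1 = i),
    ∫ x in face P M i e.2 ∩ {x | un P M i x < 0},
      pval (v i) x * (un P M i x * (tr P M c i x - tr P M c e.2 x)) ∂(surf d)) +
  (∑ e ∈ M.faces.filter (fun e => e.2 = i),
    ∫ x in face P M i e.1 ∩ {x | un P M i x < 0},
      pval (v i) x * (un P M i x * (tr P M c i x - tr P M c e.1 x)) ∂(surf d)) +
  ∫ x in bface P M i ∩ {x | un P M i x < 0},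
      pval (v i) x * (un P M i x * tr P M c i x) ∂(surf d)

/-- The bilinear form with reduced penalty, `L^S_{dfd,h}(c, v)`. On the interior face `e`, the
normal is `n_Λ = n_{e.1}`, so the average of `(A∇c)·n_Λ` is half the difference of the two
outward fluxes. -/
def Lform (α : ℝ) (c : Pt d → ℝ) (v : ι → MvPolynomial (Fin d) ℝ) : ℝ :=
  (∑ i, ∫ x in M.elem i, ⟪P.A x (weakGrad (M.elem i) c x), gradient (pval (v i)) x⟫)
  - ((∑ e ∈ dfdfFaces P M, ∫ x in face P M e.1 e.2,
        (cn P M c e.1 x - cn P M c e.2 x) / 2 * (pval (v e.1) x - pval (v e.2) x) ∂(surf d))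
      + ∑ i ∈ dirFaces P M, ∫ x in dirFace P M i, cn P M c i x * pval (v i) x ∂(surf d))
  + ((∑ e ∈ dfdfFaces P M, ∫ x in face P M e.1 e.2,
        (polyFlux P M e.1 (v e.1) (M.normal e.1) x + polyFlux P M e.2 (v e.2) (M.normal e.1) x) / 2
          * (tr P M c e.1 x - tr P M c e.2 x) ∂(surf d))
      + ∑ i ∈ dirFaces P M, ∫ x in dirFace P M i,
          polyFlux P M i (v i) (M.normal i) x * tr P M c i x ∂(surf d))
  + ((∑ e ∈ dfdFaces P M, (faceScale (face P M e.1 e.2))⁻¹ * AFace P M e *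
        ∫ x in face P M e.1 e.2,
          (tr P M c e.1 x - tr P M c e.2 x) * (pval (v e.1) x - pval (v e.2) x) ∂(surf d))
      + ∑ i ∈ dfdDirFaces P M, (faceScale (dirFace P M i))⁻¹ * ADir P M i *
          ∫ x in dirFace P M i, tr P M c i x * pval (v i) x ∂(surf d))
  + ((∑ i, ∫ x in M.elem i, advTerm P M c i x * pval (v i) x) - ∑ i, inflowTerm P M c v i)
  + (∑ i, ∫ x in M.elem i, γ0 P x * c x * pval (v i) x)
  + Sform P M α c v

/-- The linear form `R^T_h(v)` of the scheme with reduced penalty. -/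
def Rform (α : ℝ) (v : ι → MvPolynomial (Fin d) ℝ) : ℝ :=
  (∑ i, ∫ x in M.elem i, P.g x * pval (v i) x)
  + (∑ i ∈ dirFaces P M, ∫ x in dirFace P M i,
      polyFlux P M i (v i) (M.normal i) x * P.κ x ∂(surf d))
  + (∑ i ∈ dfdDirFaces P M, (faceScale (dirFace P M i))⁻¹ * ADir P M i *
      ∫ x in dirFace P M i, P.κ x * pval (v i) x ∂(surf d))
  - (∑ i, ∫ x in bface P M i ∩ {x | (nAn P M i x = 0 ∨ x ∈ P.ΓdfD) ∧ un P M i x < 0},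
      pval (v i) x * (un P M i x * P.κ x) ∂(surf d))
  - (∑ i, ∫ x in bface P M i ∩ {x | x ∈ P.ΓdfN ∧ un P M i x < 0},
      pval (v i) x * P.χm x ∂(surf d))
  - (∑ i, ∫ x in bface P M i ∩ {x | x ∈ P.ΓdfN ∧ 0 ≤ un P M i x},
      pval (v i) x * P.χp x ∂(surf d))
  + Tform P M α v

/-! ### Standing assumptions on the data, and the exact solution -/

/-- Assumptions on the data: `A` is symmetric and nonnegative, and Lipschitz on each element;
`u ∈ H(div; Ω)` and `u·n ∈ L¹(∂K)`; `g ∈ L²(Ω)`; the diffusion boundary, where `n^T A n > 0`,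
is divided into `ΓdfD` and `ΓdfN`, up to sets of surface measure zero. -/
structure DataAssumptions : Prop where
  lipschitz : IsLipschitzDomain P.Ω
  symm : ∀ᵐ x ∂(volume.restrict P.Ω), ∀ ξ η : Pt d, ⟪P.A x ξ, η⟫ = ⟪ξ, P.A x η⟫
  nonneg : ∀ᵐ x ∂(volume.restrict P.Ω), ∀ ξ : Pt d, 0 ≤ ⟪ξ, P.A x ξ⟫
  A_lipschitz : ∀ i, ∃ C, LipschitzOnWith C P.A (M.elem i)
  u_Hdiv : MemHdiv P.Ω P.u
  u_normal : ∀ i, ∃ q, IsNormalTrace (M.elem i) P.u q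
  g_mem : MemLp P.g 2 (volume.restrict P.Ω)
  ΓdfD_meas : MeasurableSet P.ΓdfD
  ΓdfN_meas : MeasurableSet P.ΓdfN
  ΓdfD_subset : P.ΓdfD ⊆ frontier P.Ω
  ΓdfN_subset : P.ΓdfN ⊆ frontier P.Ω
  Γdf_disjoint : Disjoint P.ΓdfD P.ΓdfN
  Γdf_eq : ∀ i, ∀ᵐ x ∂((surf d).restrict (bface P M i)),
    (0 < nAn P M i x ↔ x ∈ P.ΓdfD ∪ P.ΓdfN)

/-- The elementwise regularity which the terms of the scheme presuppose: on each element `c` is in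
`H¹(K)` and has a trace, the flux `A∇c` has a normal trace, and `(u·n) c` is integrable on `∂K`. -/
structure ElementwiseRegular (c : Pt d → ℝ) : Prop where
  memH1 : ∀ i, MemH1 (M.elem i) c
  trace : ∀ i, ∃ q, IsTrace (M.elem i) c q
  conormal : ∀ i, ∃ q, IsConormalTrace (M.elem i) (M.normal i) P.A c q
  integrable : ∀ i, Integrable (fun x => un P M i x * tr P M c i x) (bdry (M.elem i))

/-- The total flux `-A∇c + uc`, with the elementwise gradient. -/
def totalFlux (c : Pt d → ℝ) (x : Pt d) : Pt d :=
  ∑ i, (M.elem i).indicator (fun y => -P.A y (weakGrad (M.elem i) c y) + c y • P.u y) x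

/-- `c` is the exact solution: the total flux is in `H(div; Ω)`, the differential equation holds
almost everywhere, and the boundary conditions hold almost everywhere in the sense of traces. -/
structure IsExactSolution (c : Pt d → ℝ) : Prop where
  flux : MemHdiv P.Ω (totalFlux P M c)
  pde : ∀ᵐ x ∂(volume.restrict P.Ω), weakDiv P.Ω (totalFlux P M c) x + P.γ x * c x = P.g x
  dirichlet : ∀ i, ∀ᵐ x ∂((surf d).restrict (bface P M i)),
    (x ∈ P.ΓdfD ∨ (nAn P M i x = 0 ∧ un P M i x < 0)) → tr P M c i x = P.κ x
  neumann_inflow : ∀ i, ∀ᵐ x ∂((surf d).restrict (bface P M i)),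
    (x ∈ P.ΓdfN ∧ un P M i x < 0) →
      -cn P M c i x + un P M i x * tr P M c i x = P.χm x
  neumann_outflow : ∀ i, ∀ᵐ x ∂((surf d).restrict (bface P M i)),
    (x ∈ P.ΓdfN ∧ 0 ≤ un P M i x) → -cn P M c i x = P.χp x

end Scheme

end AdvDiffDG

end

open AdvDiffDG

/-!
Consistency holds because the scheme is integration by parts, element by element, followed by a
bookkeeping of the boundary terms.

On an element `K` the product rule `div (c u) = u · ∇c + c div u` turns the volume terms into
`∫_K (A∇c · ∇v + div (A∇c) v) + ∫_K (div (-A∇c + cu) + γ c) v`. The differential equation makes the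
second integral `∫_K g v`, and the first one is `∫_{∂K} (A∇c · n) v` (`elementwise_identity`). The same
rule shows that the residual in the stabilization form is `g` (`residual_ae_eq`).

The boundary integrals split into integrals over the interior faces and over `∂K ∩ ∂Ω`
(`integral_bdry_eq`; here one needs that a Lipschitz element lies on one side of its boundary). Since
`u` and the total flux `-A∇c + cu` have a divergence in all of `Ω`, their normal traces from the two
sides of a face cancel (`normalTrace_add_eq_zero`), so that the sum of the two outward diffusive
fluxes is `u · n [c]` (`cn_add_cn`). Moreover `nᵀAn = 0` forces `An = 0`, so there is no diffusive flux
on a side without diffusion (`cn_eq_zero_of_nAn_eq_zero`). On diffusion-diffusion faces this leaves the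
average flux of the scheme, and on all other faces the one-sided diffusive fluxes are exactly the
upwind terms (`face_identity`). On an inflow advection-diffusion face `[c]` need not vanish: the
diffusive flux on the diffusion side balances the jump of the advective flux. On `∂Ω` the boundary
conditions do the rest (`bface_identity`).

Two facts about normal traces carry the analysis.

* The diffusive flux of the scheme is the normal trace of `A∇c` (`IsConormalTrace.isNormalTrace`).
  For smooth fields this is the divergence theorem for Lipschitz fields
  (`IsOutwardNormal.isNormalTrace_of_lipschitz`), which follows by mollification from the defining
  property of the exterior normal; the general case is a limit.
* The product `(u · n) c` of the traces is the normal trace of `c u`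
  (`IsNormalTrace.smul_of_isTrace`). As `u · n` is merely integrable, the smooth approximations of `c`
  have to be truncated before passing to the limit on the boundary.
-/

noncomputable section

namespace AdvDiffDG

/-! ### Test functions and gradients -/

section Calculus

variable {d : ℕ}

theorem inner_gradient_eq_fderiv (φ : Pt d → ℝ) (x v : Pt d) :
    ⟪v, gradient φ x⟫ = fderiv ℝ φ x v := by
  rw [real_inner_comm]; exact inner_gradient_left

theorem inner_gradient_eq_lineDeriv {φ : Pt d → ℝ} {x : Pt d} (h : DifferentiableAt ℝ φ x)
    (v : Pt d) : ⟪v, gradient φ x⟫ = lineDeriv ℝ φ x v := by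
  rw [inner_gradient_eq_fderiv, h.lineDeriv_eq_fderiv]

theorem gradient_mul {φ ψ : Pt d → ℝ} {x : Pt d} (h : DifferentiableAt ℝ φ x)
    (h' : DifferentiableAt ℝ ψ x) :
    gradient (fun x => φ x * ψ x) x = φ x • gradient ψ x + ψ x • gradient φ x := by
  simp only [gradient, fderiv_fun_mul h h', map_add, map_smul]

theorem gradient_comp {φ : Pt d → ℝ} {x : Pt d} {T : ℝ → ℝ} {T' : ℝ} (hT : HasDerivAt T T' (φ x))
    (h : DifferentiableAt ℝ φ x) :
    gradient (fun x => T (φ x)) x = T' • gradient φ x := by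
  have := (hT.comp_hasFDerivAt x h.hasFDerivAt).fderiv
  simp only [Function.comp_def] at this
  simp only [gradient, this, map_smul]

theorem contDiff_differentiable {F : Type*} [NormedAddCommGroup F] [NormedSpace ℝ F]
    {φ : Pt d → F} (h : ContDiff ℝ ∞ φ) : Differentiable ℝ φ :=
  h.differentiable (by simp)

theorem continuous_gradient {φ : Pt d → ℝ} (h : ContDiff ℝ ∞ φ) : Continuous (gradient φ) :=
  (InnerProductSpace.toDual ℝ (Pt d)).symm.continuous.comp (h.continuous_fderiv (by simp))

theorem tsupport_gradient_subset (φ : Pt d → ℝ) : tsupport (gradient φ) ⊆ tsupport φ := by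
  refine (closure_mono fun x hx => ?_).trans (tsupport_fderiv_subset ℝ (f := φ))
  rw [Function.mem_support] at hx ⊢
  exact fun h => hx (by simp [gradient, h])

theorem IsTest.exists_bound_gradient {φ : Pt d → ℝ} (h : IsTest φ) :
    ∃ C, ∀ x, ‖gradient φ x‖ ≤ C :=
  HasCompactSupport.exists_bound_of_continuous
    (h.2.of_isClosed_subset (isClosed_tsupport _) (tsupport_gradient_subset φ))
    (continuous_gradient h.1)

theorem IsTest.exists_bound {φ : Pt d → ℝ} (h : IsTest φ) : ∃ C, ∀ x, ‖φ x‖ ≤ C :=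
  h.2.exists_bound_of_continuous h.1.continuous

theorem IsTest.mul_left {φ ψ : Pt d → ℝ} (h : IsTest φ) (hψ : ContDiff ℝ ∞ ψ) :
    IsTest (fun x => ψ x * φ x) :=
  ⟨hψ.mul h.1, h.2.mul_left⟩

/-- A smooth cut-off function which is `1` near the closure of a bounded set. -/
theorem exists_isTest_eventuallyEq_one {K : Set (Pt d)} (hK : Bornology.IsBounded K) :
    ∃ χ : Pt d → ℝ, IsTest χ ∧ ∀ x ∈ closure K, χ =ᶠ[𝓝 x] 1 := by
  obtain ⟨R, hR0, hR⟩ := hK.subset_closedBall_lt 0 (0 : Pt d)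
  let χ : ContDiffBump (0 : Pt d) := ⟨R + 1, R + 2, by linarith, by linarith⟩
  refine ⟨χ, ⟨χ.contDiff, χ.hasCompactSupport⟩, fun x hx => χ.eventuallyEq_one_of_mem_ball ?_⟩
  have := closure_minimal hR Metric.isClosed_closedBall hx
  rw [Metric.mem_closedBall] at this
  rw [Metric.mem_ball]
  exact this.trans_lt (show R < R + 1 by linarith)

end Calculus

/-! ### Limits of integrals -/

section Limits

variable {X : Type*} [MeasurableSpace X] {μ : Measure X}

/-- Integrals converge if the integrands differ by at most `w ‖g_k - g‖` with `w ∈ L²` and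
`g_k → g` in `L²`. -/
theorem tendsto_integral_of_le_mul_L2 {F : Type*} [NormedAddCommGroup F]
    {H : ℕ → X → ℝ} {H₀ : X → ℝ} {g : ℕ → X → F} {g₀ : X → F} {w : X → ℝ}
    (hH : ∀ k, Integrable (H k) μ) (hH₀ : Integrable H₀ μ) (hw : MemLp w 2 μ)
    (hg : ∀ k, AEStronglyMeasurable (fun x => g k x - g₀ x) μ)
    (hlim : Tendsto (fun k => eLpNorm (fun x => g k x - g₀ x) 2 μ) atTop (𝓝 0))
    (hle : ∀ k, ∀ᵐ x ∂μ, ‖H k x - H₀ x‖ ≤ ‖w x‖ * ‖g k x - g₀ x‖) :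
    Tendsto (fun k => ∫ x, H k x ∂μ) atTop (𝓝 (∫ x, H₀ x ∂μ)) := by
  refine tendsto_integral_of_L1' _ hH₀.1 (.of_forall hH) ?_
  have h0 : Tendsto (fun k => eLpNorm w 2 μ * eLpNorm (fun x => g k x - g₀ x) 2 μ) atTop (𝓝 0) := by
    simpa using ENNReal.Tendsto.const_mul hlim (.inr hw.eLpNorm_ne_top)
  refine tendsto_of_tendsto_of_tendsto_of_le_of_le tendsto_const_nhds h0 (fun _ => zero_le) fun k => ?_
  calc eLpNorm (H k - H₀) 1 μ
      ≤ eLpNorm ((fun x => ‖w x‖) • (fun x => ‖g k x - g₀ x‖)) 1 μ := by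
        refine eLpNorm_mono_ae ?_
        filter_upwards [hle k] with x hx
        simpa using hx
    _ ≤ eLpNorm (fun x => ‖w x‖) 2 μ * eLpNorm (fun x => ‖g k x - g₀ x‖) 2 μ :=
        eLpNorm_smul_le_mul_eLpNorm (hg k).norm hw.1.norm
    _ = _ := by rw [eLpNorm_norm, eLpNorm_norm]

/-- Integrals against a bounded weight are continuous for convergence in `L¹`. -/
theorem tendsto_integral_mul_of_L1 {g : ℕ → X → ℝ} {g₀ w : X → ℝ} {C : ℝ}
    (hw : AEStronglyMeasurable w μ) (hC : ∀ x, ‖w x‖ ≤ C)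
    (hg : ∀ k, Integrable (g k) μ) (hg₀ : Integrable g₀ μ)
    (hlim : Tendsto (fun k => eLpNorm (fun x => g k x - g₀ x) 1 μ) atTop (𝓝 0)) :
    Tendsto (fun k => ∫ x, g k x * w x ∂μ) atTop (𝓝 (∫ x, g₀ x * w x ∂μ)) := by
  have hi : ∀ {f : X → ℝ}, Integrable f μ → Integrable (fun x => f x * w x) μ := fun hf =>
    hf.mul_bdd hw (.of_forall hC)
  refine tendsto_integral_of_L1' _ (hi hg₀).1 (.of_forall fun k => hi (hg k)) ?_
  have h0 : Tendsto (fun k => ENNReal.ofReal C * eLpNorm (fun x => g k x - g₀ x) 1 μ)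
      atTop (𝓝 0) := by
    simpa using ENNReal.Tendsto.const_mul hlim (.inr ENNReal.ofReal_ne_top)
  refine tendsto_of_tendsto_of_tendsto_of_le_of_le tendsto_const_nhds h0 (fun _ => zero_le) fun k => ?_
  refine eLpNorm_le_mul_eLpNorm_of_ae_le_mul (.of_forall fun x => ?_) 1
  simp only [Pi.sub_apply, ← sub_mul, norm_mul]
  rw [mul_comm]
  gcongr
  exact hC x

/-- A sequence which converges in `L²` has a subsequence which converges almost everywhere. -/
theorem exists_subseq_tendsto_ae_of_L2 {f : ℕ → X → ℝ} {f₀ : X → ℝ}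
    (hf : ∀ k, AEStronglyMeasurable (f k) μ) (hf₀ : AEStronglyMeasurable f₀ μ)
    (hlim : Tendsto (fun k => eLpNorm (fun x => f k x - f₀ x) 2 μ) atTop (𝓝 0)) :
    ∃ ns : ℕ → ℕ, StrictMono ns ∧
      ∀ᵐ x ∂μ, Tendsto (fun k => f (ns k) x) atTop (𝓝 (f₀ x)) :=
  (tendstoInMeasure_of_tendsto_eLpNorm (p := 2) (by simp) hf hf₀ hlim).exists_seq_tendsto_ae

end Limits

/-! ### Weak derivatives and normal traces -/

section Weak

variable {d : ℕ} {U V K : Set (Pt d)}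

theorem integrable_smul_of_tsupport_subset {F : Type*} [NormedAddCommGroup F] [NormedSpace ℝ F]
    {w : Pt d → F} {φ : Pt d → ℝ} (hw : LocallyIntegrableOn w U) (hφ : IsTest φ)
    (hs : tsupport φ ⊆ U) : Integrable (fun x => φ x • w x) := by
  have h := (hw.integrableOn_compact_subset hs hφ.2).continuousOn_smul
    hφ.1.continuous.continuousOn hφ.2
  refine (integrableOn_iff_integrable_of_support_subset fun x hx => ?_).1 h
  exact subset_tsupport _ (by
    rw [Function.mem_support] at hx ⊢
    exact fun h => hx (by simp [h]))

theorem ae_eq_of_forall_isTest {F : Type*} [NormedAddCommGroup F] [NormedSpace ℝ F]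
    [CompleteSpace F] {w w' : Pt d → F} (hU : IsOpen U) (hw : LocallyIntegrableOn w U)
    (hw' : LocallyIntegrableOn w' U)
    (h : ∀ φ : Pt d → ℝ, IsTest φ → tsupport φ ⊆ U →
      ∫ x in U, φ x • w x = ∫ x in U, φ x • w' x) :
    w =ᵐ[volume.restrict U] w' := by
  have key := hU.ae_eq_zero_of_integral_contDiff_smul_eq_zero (μ := volume) (hw.sub hw')
    fun φ h1 h2 h3 => by
      have e := h φ ⟨h1, h2⟩ h3
      have z : ∀ x ∉ U, φ x = 0 := fun x hx => image_eq_zero_of_notMem_tsupport fun h => hx (h3 h)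
      rw [setIntegral_eq_integral_of_forall_compl_eq_zero fun x hx => by simp [z x hx],
        setIntegral_eq_integral_of_forall_compl_eq_zero fun x hx => by simp [z x hx]] at e
      simp only [Pi.sub_apply, smul_sub]
      rw [integral_sub (integrable_smul_of_tsupport_subset hw ⟨h1, h2⟩ h3)
        (integrable_smul_of_tsupport_subset hw' ⟨h1, h2⟩ h3), e, sub_self]
  rw [Filter.EventuallyEq, ae_restrict_iff' hU.measurableSet]
  filter_upwards [key] with x hx hxU
  exact sub_eq_zero.1 (hx hxU)

theorem HasWeakDiv.ae_eq {σ : Pt d → Pt d} {δ δ' : Pt d → ℝ} (hU : IsOpen U)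
    (h : HasWeakDiv U σ δ) (h' : HasWeakDiv U σ δ') : δ =ᵐ[volume.restrict U] δ' := by
  refine ae_eq_of_forall_isTest hU h.2.1 h'.2.1 fun φ hφ hs => ?_
  have := (h.2.2 φ hφ hs).symm.trans (h'.2.2 φ hφ hs)
  simp only [smul_eq_mul, mul_comm (φ _)]
  linarith

theorem HasWeakGrad.ae_eq {f : Pt d → ℝ} {w w' : Pt d → Pt d} (hU : IsOpen U)
    (h : HasWeakGrad U f w) (h' : HasWeakGrad U f w') : w =ᵐ[volume.restrict U] w' := by
  refine ae_eq_of_forall_isTest hU h.2.1 h'.2.1 fun φ hφ hs => ?_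
  exact neg_injective ((h.2.2 φ hφ hs).symm.trans (h'.2.2 φ hφ hs))

theorem HasWeakDiv.weakDiv {σ : Pt d → Pt d} {δ : Pt d → ℝ} (h : HasWeakDiv U σ δ) :
    HasWeakDiv U σ (weakDiv U σ) := by
  have h' : ∃ δ, HasWeakDiv U σ δ := ⟨δ, h⟩
  rw [AdvDiffDG.weakDiv, dif_pos h']
  exact h'.choose_spec

theorem HasWeakGrad.weakGrad {f : Pt d → ℝ} {w : Pt d → Pt d} (h : HasWeakGrad U f w) :
    HasWeakGrad U f (weakGrad U f) := by
  have h' : ∃ w, HasWeakGrad U f w := ⟨w, h⟩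
  rw [AdvDiffDG.weakGrad, dif_pos h']
  exact h'.choose_spec

theorem MemH1.memLp_weakGrad {f : Pt d → ℝ} (hU : IsOpen U) (h : MemH1 U f) :
    MemLp (weakGrad U f) 2 (volume.restrict U) := by
  obtain ⟨_, w, hw, hw2⟩ := h
  exact hw2.ae_eq (hw.ae_eq hU hw.weakGrad)

theorem MemHdiv.hasWeakDiv {σ : Pt d → Pt d} (h : MemHdiv U σ) :
    HasWeakDiv U σ (weakDiv U σ) := by
  obtain ⟨_, δ, hδ, _⟩ := h
  exact hδ.weakDiv

theorem MemHdiv.memLp_weakDiv {σ : Pt d → Pt d} (hU : IsOpen U) (h : MemHdiv U σ) :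
    MemLp (weakDiv U σ) 2 (volume.restrict U) := by
  obtain ⟨_, δ, hδ, hδ2⟩ := h
  exact hδ2.ae_eq (hδ.ae_eq hU hδ.weakDiv)

theorem setIntegral_eq_of_subset_of_eq_zero {f : Pt d → ℝ} (hU : IsOpen U) (hVU : V ⊆ U)
    (h : ∀ x ∉ V, f x = 0) : ∫ x in U, f x = ∫ x in V, f x :=
  (setIntegral_eq_of_subset_of_forall_sdiff_eq_zero hU.measurableSet hVU fun x hx => h x hx.2)

theorem HasWeakDiv.mono {σ : Pt d → Pt d} {δ : Pt d → ℝ} (hU : IsOpen U)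
    (h : HasWeakDiv U σ δ) (hVU : V ⊆ U) : HasWeakDiv V σ δ := by
  refine ⟨h.1.mono_set hVU, h.2.1.mono_set hVU, fun φ hφ hs => ?_⟩
  have := h.2.2 φ hφ (hs.trans hVU)
  rwa [setIntegral_eq_of_subset_of_eq_zero hU hVU, setIntegral_eq_of_subset_of_eq_zero hU hVU]
    at this
  · intro x hx
    simp [image_eq_zero_of_notMem_tsupport fun h => hx (hs h)]
  · intro x hx
    have : gradient φ x = 0 :=
      image_eq_zero_of_notMem_tsupport fun h => hx (hs (tsupport_gradient_subset φ h))
    simp [this]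

/-- Weak divergences depend only on the values of the field on the set. -/
theorem HasWeakDiv.congr {σ σ' : Pt d → Pt d} {δ : Pt d → ℝ} (hU : IsOpen U)
    (h : HasWeakDiv U σ δ) (he : EqOn σ σ' U) : HasWeakDiv U σ' δ := by
  have hloc : LocallyIntegrableOn σ' U := fun x hx => by
    obtain ⟨t, ht, hi⟩ := h.1 x hx
    refine ⟨t ∩ U, inter_mem ht self_mem_nhdsWithin, ?_⟩
    refine (hi.mono_set inter_subset_left).congr ?_
    exact ae_restrict_of_ae_restrict_of_subset inter_subset_right
      ((ae_restrict_mem hU.measurableSet).mono fun y hy => he hy)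
  refine ⟨hloc, h.2.1, fun φ hφ hs => ?_⟩
  rw [← h.2.2 φ hφ hs]
  exact setIntegral_congr_fun hU.measurableSet fun x hx => by simp only [he hx]

end Weak

section NormalTraces

variable {d : ℕ} {K : Set (Pt d)} {σ : Pt d → Pt d} {δ q : Pt d → ℝ}

theorem IsTest.integrable_mul {μ : Measure (Pt d)} {φ f : Pt d → ℝ} (hφ : IsTest φ)
    (hf : Integrable f μ) : Integrable (fun x => f x * φ x) μ := by
  obtain ⟨C, hC⟩ := hφ.exists_bound
  exact hf.mul_bdd hφ.1.continuous.aestronglyMeasurable (.of_forall hC)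

theorem IsTest.integrable_inner_gradient {μ : Measure (Pt d)} {φ : Pt d → ℝ} (hφ : IsTest φ)
    (hσ : Integrable σ μ) : Integrable (fun x => ⟪σ x, gradient φ x⟫) μ := by
  obtain ⟨C, hC⟩ := hφ.exists_bound_gradient
  refine (hσ.norm.mul_const C).mono'
    (hσ.1.inner (continuous_gradient hφ.1).aestronglyMeasurable) (.of_forall fun x => ?_)
  exact (norm_inner_le_norm _ _).trans (by gcongr; exact hC x)

/-- The Green identity for the normal trace holds with every weak divergence of the field. -/
theorem IsNormalTrace.green (hK : IsOpen K) (h : IsNormalTrace K σ q) (hδ : HasWeakDiv K σ δ) :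
    IntegrableOn δ K ∧ ∀ φ : Pt d → ℝ, IsTest φ →
      ∫ x in K, (⟪σ x, gradient φ x⟫ + δ x * φ x) = ∫ x, q x * φ x ∂(bdry K) := by
  obtain ⟨_, δ', hδ', hi, hid⟩ := h
  have e := hδ'.ae_eq hK hδ
  refine ⟨hi.congr e, fun φ hφ => ?_⟩
  rw [← hid φ hφ]
  refine integral_congr_ae ?_
  filter_upwards [e] with x hx
  rw [hx]

/-- On a bounded set the Green identity holds for smooth functions without compact support as
well. -/
theorem IsNormalTrace.green_of_contDiff (hK : IsOpen K) (hb : Bornology.IsBounded K)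
    (h : IsNormalTrace K σ q) (hδ : HasWeakDiv K σ δ) {φ : Pt d → ℝ} (hφ : ContDiff ℝ ∞ φ) :
    ∫ x in K, (⟪σ x, gradient φ x⟫ + δ x * φ x) = ∫ x, q x * φ x ∂(bdry K) := by
  obtain ⟨χ, hχ, hχ1⟩ := exists_isTest_eventuallyEq_one hb
  have hev : ∀ x ∈ closure K, (fun x => φ x * χ x) =ᶠ[𝓝 x] φ := fun x hx => by
    filter_upwards [hχ1 x hx] with y hy
    simp [hy]
  have := (h.green hK hδ).2 _ (hχ.mul_left hφ)
  have e1 : ∫ x in K, (⟪σ x, gradient (fun x => φ x * χ x) x⟫ + δ x * (φ x * χ x))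
      = ∫ x in K, (⟪σ x, gradient φ x⟫ + δ x * φ x) :=
    setIntegral_congr_fun hK.measurableSet fun x hx => by
      have := hev x (subset_closure hx)
      simp only [this.gradient_eq]
      rw [show φ x * χ x = φ x from this.self_of_nhds]
  have e2 : ∫ x, q x * (φ x * χ x) ∂(bdry K) = ∫ x, q x * φ x ∂(bdry K) :=
    setIntegral_congr_fun isClosed_frontier.measurableSet fun x hx => by
      have := hev x hx.1
      rw [show φ x * χ x = φ x from this.self_of_nhds]
  rw [← e1, ← e2, this]

/-- The Green identity for an integrable field and an integrable function `δ` shows that `δ` is the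
weak divergence, because the boundary integral vanishes for test functions supported in `K`. -/
theorem isNormalTrace_of_green (hK : IsOpen K) (hq : Integrable q (bdry K))
    (hσ : IntegrableOn σ K) (hδ : IntegrableOn δ K)
    (h : ∀ φ : Pt d → ℝ, IsTest φ →
      ∫ x in K, (⟪σ x, gradient φ x⟫ + δ x * φ x) = ∫ x, q x * φ x ∂(bdry K)) :
    HasWeakDiv K σ δ ∧ IsNormalTrace K σ q := by
  have hw : HasWeakDiv K σ δ := by
    refine ⟨hσ.locallyIntegrableOn, hδ.locallyIntegrableOn, fun φ hφ hs => ?_⟩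
    have h0 : ∫ x, q x * φ x ∂(bdry K) = 0 := by
      rw [bdry, setIntegral_eq_zero_of_forall_eq_zero]
      intro x hx
      have : x ∉ tsupport φ := fun h => (hK.frontier_eq ▸ hx).2 (hs h)
      simp [image_eq_zero_of_notMem_tsupport this]
    have := h φ hφ
    rw [h0, integral_add (hφ.integrable_inner_gradient hσ) (hφ.integrable_mul hδ)] at this
    linarith
  exact ⟨hw, hq, δ, hw, hδ, h⟩

theorem IsNormalTrace.congr {σ' : Pt d → Pt d} {q' : Pt d → ℝ} (hK : IsOpen K)
    (h : IsNormalTrace K σ q) (hσ : EqOn σ σ' K) (hq : q =ᵐ[bdry K] q') :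
    IsNormalTrace K σ' q' := by
  obtain ⟨hi, δ, hδ, hδi, hid⟩ := h
  refine ⟨hi.congr hq, δ, hδ.congr hK hσ, hδi, fun φ hφ => ?_⟩
  have e : ∫ x, q x * φ x ∂(bdry K) = ∫ x, q' x * φ x ∂(bdry K) :=
    integral_congr_ae (hq.mono fun x hx => by simp only [hx])
  rw [← e, ← hid φ hφ]
  exact setIntegral_congr_fun hK.measurableSet fun x hx => by simp only [hσ hx]

theorem IsNormalTrace.add {σ' : Pt d → Pt d} {q' : Pt d → ℝ} (hK : IsOpen K)
    (h : IsNormalTrace K σ q) (h' : IsNormalTrace K σ' q') (hσ : IntegrableOn σ K)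
    (hσ' : IntegrableOn σ' K) :
    IsNormalTrace K (fun x => σ x + σ' x) (fun x => q x + q' x) := by
  obtain ⟨hq, δ, hδ, hi, hid⟩ := h
  obtain ⟨hq', δ', hδ', hi', hid'⟩ := h'
  refine (isNormalTrace_of_green hK (hq.add hq') (hσ.add hσ') (hi.add hi') fun φ hφ => ?_).2
  have e1 := integral_add ((hφ.integrable_inner_gradient hσ).add (hφ.integrable_mul hi))
    ((hφ.integrable_inner_gradient hσ').add (hφ.integrable_mul hi'))
  have e2 := integral_add (hφ.integrable_mul hq) (hφ.integrable_mul hq')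
  simp only [Pi.add_apply] at e1
  simp only [Pi.add_apply, add_mul]
  rw [e2, ← hid φ hφ, ← hid' φ hφ, ← e1]
  congr 1 with x
  rw [inner_add_left]
  ring

theorem IsNormalTrace.neg (hK : IsOpen K) (h : IsNormalTrace K σ q) (hσ : IntegrableOn σ K) :
    IsNormalTrace K (fun x => -σ x) (fun x => -q x) := by
  obtain ⟨hq, δ, hδ, hi, hid⟩ := h
  refine (isNormalTrace_of_green hK hq.neg hσ.neg hi.neg fun φ hφ => ?_).2
  simp only [Pi.neg_apply, neg_mul, integral_neg, ← hid φ hφ, inner_neg_left, ← neg_add]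

end NormalTraces

/-! ### The divergence theorem for Lipschitz functions -/

section Gauss

variable {d : ℕ} {K : Set (Pt d)} {n : Pt d → Pt d}

theorem norm_normed_convolution_le (ρ : ContDiffBump (0 : Pt d)) {g : Pt d → ℝ} {M : ℝ}
    (hg : ∀ x, ‖g x‖ ≤ M) (x : Pt d) :
    ‖convolution (ρ.normed volume) g (ContinuousLinearMap.lsmul ℝ ℝ) volume x‖ ≤ M := by
  have hi : Integrable (fun t => ρ.normed volume t * M) volume :=
    (ρ.continuous_normed.integrable_of_hasCompactSupport ρ.hasCompactSupport_normed).mul_const M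
  calc _ ≤ ∫ t, ρ.normed volume t * M := by
        refine norm_integral_le_of_norm_le hi (.of_forall fun t => ?_)
        simp only [ContinuousLinearMap.lsmul_apply, smul_eq_mul, norm_mul]
        rw [Real.norm_of_nonneg (ρ.nonneg_normed t)]
        exact mul_le_mul_of_nonneg_left (hg _) (ρ.nonneg_normed t)
    _ = M := by rw [integral_mul_const, ρ.integral_normed, one_mul]

/-- Mollification commutes with the derivatives of a Lipschitz function. -/
theorem lineDeriv_normed_convolution (ρ : ContDiffBump (0 : Pt d)) {f : Pt d → ℝ} {C : NNReal}
    (hf : LipschitzWith C f) (x v : Pt d) :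
    lineDeriv ℝ (convolution (ρ.normed volume) f (ContinuousLinearMap.lsmul ℝ ℝ) volume) x v =
      convolution (ρ.normed volume) (fun y => lineDeriv ℝ f y v)
        (ContinuousLinearMap.lsmul ℝ ℝ) volume x := by
  have hρ1 : ContDiff ℝ 1 (ρ.normed volume) := ρ.contDiff_normed
  have hD := ρ.hasCompactSupport_normed.hasFDerivAt_convolution_left
    (ContinuousLinearMap.lsmul ℝ ℝ) hρ1 (hf.continuous.locallyIntegrable (μ := volume)) x
  rw [hD.differentiableAt.lineDeriv_eq_fderiv, hD.fderiv]
  have hce : ConvolutionExistsAt (fderiv ℝ (ρ.normed volume)) f x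
      (ContinuousLinearMap.precompL (Pt d) (ContinuousLinearMap.lsmul ℝ ℝ)) volume :=
    ρ.hasCompactSupport_normed.fderiv (𝕜 := ℝ) |>.convolutionExists_left _
      (hρ1.continuous_fderiv (by simp)) hf.continuous.locallyIntegrable x
  rw [convolution, ContinuousLinearMap.integral_apply hce]
  obtain ⟨D, hD⟩ := hρ1.lipschitzWith_of_hasCompactSupport ρ.hasCompactSupport_normed (by simp)
  have hfl : LipschitzWith C (fun t => f (x - t)) := by
    simpa [Function.comp_def] using
      hf.comp ((LipschitzWith.const (α := Pt d) x).sub LipschitzWith.id)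
  have key := hfl.integral_lineDeriv_mul_eq (μ := volume) hD ρ.hasCompactSupport_normed (-v)
  simp only [convolution, ContinuousLinearMap.precompL_apply, ContinuousLinearMap.lsmul_apply,
    smul_eq_mul]
  rw [neg_neg] at key
  have e1 : ∀ t, lineDeriv ℝ (ρ.normed volume) t v = fderiv ℝ (ρ.normed volume) t v := fun t =>
    (hρ1.differentiable (by simp) t).lineDeriv_eq_fderiv
  have e2 : ∀ t, lineDeriv ℝ (fun t => f (x - t)) t (-v) = lineDeriv ℝ f (x - t) v := fun t => by
    simp only [lineDeriv]
    congr 1 with s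
    congr 1
    rw [smul_neg]
    abel
  simp only [e1, e2] at key
  rw [← key]
  simp only [mul_comm]

theorem isFiniteMeasure_bdry (hfin : surf d (frontier K) < ⊤) : IsFiniteMeasure (bdry K) :=
  ⟨by rwa [bdry, Measure.restrict_apply_univ]⟩

theorem IsOutwardNormal.integral_inner_gradient (hfin : surf d (frontier K) < ⊤)
    (hKfin : volume K < ⊤)
    (hn : IsOutwardNormal K n) {φ : Pt d → ℝ} (hφ : IsTest φ) (v : Pt d) :
    ∫ x in K, ⟪v, gradient φ x⟫ = ∫ x, φ x * ⟪v, n x⟫ ∂(bdry K) := by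
  have := isFiniteMeasure_bdry hfin
  have : IsFiniteMeasure (volume.restrict K) := ⟨by rwa [Measure.restrict_apply_univ]⟩
  obtain ⟨hm, h1, h⟩ := hn
  obtain ⟨C, hC⟩ := hφ.exists_bound
  obtain ⟨C', hC'⟩ := hφ.exists_bound_gradient
  have hin : Integrable (fun x => φ x • n x) (bdry K) := by
    refine Integrable.of_bound (hφ.1.continuous.aestronglyMeasurable.smul hm) C ?_
    filter_upwards [h1] with x hx
    rw [norm_smul, hx, mul_one]
    exact hC x
  have hig : Integrable (gradient φ) (volume.restrict K) :=
    Integrable.of_bound (continuous_gradient hφ.1).aestronglyMeasurable C' (.of_forall hC')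
  rw [integral_inner hig v, h φ hφ, ← integral_inner hin v]
  simp only [inner_smul_right]

/-- The divergence theorem for Lipschitz functions, by mollification. -/
theorem IsOutwardNormal.integral_lineDeriv (hfin : surf d (frontier K) < ⊤)
    (hKfin : volume K < ⊤) (hn : IsOutwardNormal K n) {f : Pt d → ℝ} {C : NNReal}
    (hf : LipschitzWith C f) (hc : HasCompactSupport f) (v : Pt d) :
    ∫ x in K, lineDeriv ℝ f x v = ∫ x, f x * ⟪v, n x⟫ ∂(bdry K) := by
  have := isFiniteMeasure_bdry hfin
  have : IsFiniteMeasure (volume.restrict K) := ⟨by rwa [Measure.restrict_apply_univ]⟩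
  let ρ : ℕ → ContDiffBump (0 : Pt d) := fun k =>
    ⟨1 / ((k : ℝ) + 1), 2 / ((k : ℝ) + 1), by positivity, by gcongr; norm_num⟩
  have hρ : Tendsto (fun k => (ρ k).rOut) atTop (𝓝 0) := by
    have := (tendsto_one_div_add_atTop_nhds_zero_nat (𝕜 := ℝ)).const_mul 2
    simpa [ρ, div_eq_mul_inv] using this
  let g : ℕ → Pt d → ℝ := fun k =>
    convolution ((ρ k).normed volume) f (ContinuousLinearMap.lsmul ℝ ℝ) volume
  have hgt : ∀ k, IsTest (g k) := fun k =>
    ⟨(ρ k).hasCompactSupport_normed.contDiff_convolution_left _ (ρ k).contDiff_normed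
      hf.continuous.locallyIntegrable, (ρ k).hasCompactSupport_normed.convolution _ hc⟩
  have hid : ∀ k, ∫ x in K, lineDeriv ℝ (g k) x v = ∫ x, g k x * ⟪v, n x⟫ ∂(bdry K) := fun k => by
    rw [← hn.integral_inner_gradient hfin hKfin (hgt k) v]
    congr 1 with x
    rw [inner_gradient_eq_lineDeriv (contDiff_differentiable (hgt k).1 x)]
  obtain ⟨M, hM⟩ := hc.exists_bound_of_continuous hf.continuous
  have hL : Tendsto (fun k => ∫ x in K, lineDeriv ℝ (g k) x v) atTop
      (𝓝 (∫ x in K, lineDeriv ℝ f x v)) := by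
    refine tendsto_integral_of_dominated_convergence (fun _ => C * ‖v‖) (fun k => ?_)
      (integrable_const _) (fun k => .of_forall fun x => ?_) ?_
    · exact (measurable_lineDeriv (hgt k).1.continuous).aestronglyMeasurable
    · rw [lineDeriv_normed_convolution _ hf]
      exact norm_normed_convolution_le _ (fun y => norm_lineDeriv_le_of_lipschitz ℝ hf) x
    · refine ae_restrict_of_ae ?_
      filter_upwards [ContDiffBump.ae_convolution_tendsto_right_of_locallyIntegrable (K := 2)
        (φ := ρ) hρ (.of_forall fun k => by simp only [ρ]; field_simp; norm_num)
        (hf.locallyIntegrable_lineDeriv (μ := volume) v)] with x hx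
      simpa only [g, lineDeriv_normed_convolution _ hf] using hx
  have hR : Tendsto (fun k => ∫ x, g k x * ⟪v, n x⟫ ∂(bdry K)) atTop
      (𝓝 (∫ x, f x * ⟪v, n x⟫ ∂(bdry K))) := by
    have hnm : AEStronglyMeasurable (fun x => ⟪v, n x⟫) (bdry K) :=
      aestronglyMeasurable_const.inner hn.1
    refine tendsto_integral_of_dominated_convergence (fun _ => M * ‖v‖) (fun k => ?_)
      (integrable_const _) (fun k => ?_) (.of_forall fun x => ?_)
    · exact (hgt k).1.continuous.aestronglyMeasurable.mul hnm
    · filter_upwards [hn.2.1] with x hx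
      rw [norm_mul]
      gcongr
      · exact (norm_nonneg _).trans (hM 0)
      · exact norm_normed_convolution_le _ hM x
      · simpa [hx] using norm_inner_le_norm (𝕜 := ℝ) v (n x)
    · exact (ContDiffBump.convolution_tendsto_right_of_continuous hρ hf.continuous x).mul_const _
  exact tendsto_nhds_unique hL (by simpa only [hid] using hR)

end Gauss

section LipschitzFields

variable {d : ℕ} {K : Set (Pt d)} {n : Pt d → Pt d}

/-- A bilinear expression in two Lipschitz functions, one of them with compact support, is
Lipschitz. -/
theorem exists_lipschitzWith_bilinear {F G H : Type*} [NormedAddCommGroup F] [NormedSpace ℝ F]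
    [NormedAddCommGroup G] [NormedSpace ℝ G] [NormedAddCommGroup H] [NormedSpace ℝ H]
    (L : F →L[ℝ] G →L[ℝ] H) {a : Pt d → F} {b : Pt d → G} {Ca Cb : NNReal}
    (ha : LipschitzWith Ca a) (hb : LipschitzWith Cb b) (hc : HasCompactSupport b) :
    ∃ C, LipschitzWith C (fun x => L (a x) (b x)) := by
  obtain ⟨M, hM⟩ := hc.exists_bound_of_continuousOn (f := a) ha.continuous.continuousOn
  obtain ⟨N, hN⟩ := hc.exists_bound_of_continuous hb.continuous
  have hN0 : 0 ≤ N := (norm_nonneg _).trans (hN 0)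
  have key : ∀ x ∈ tsupport b, ∀ y, ‖L (a x) (b x) - L (a y) (b y)‖ ≤
      ‖L‖ * (|M| * Cb + Ca * N) * ‖x - y‖ := fun x hx y => by
    have e : L (a x) (b x) - L (a y) (b y) = L (a x) (b x - b y) + L (a x - a y) (b y) := by
      simp only [map_sub, sub_apply]; abel
    rw [e]
    calc _ ≤ ‖L‖ * ‖a x‖ * ‖b x - b y‖ + ‖L‖ * ‖a x - a y‖ * ‖b y‖ :=
          (norm_add_le _ _).trans (add_le_add (L.le_opNorm₂ _ _) (L.le_opNorm₂ _ _))
      _ ≤ ‖L‖ * |M| * (Cb * ‖x - y‖) + ‖L‖ * (Ca * ‖x - y‖) * N := by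
          gcongr
          · exact (hM x hx).trans (le_abs_self M)
          · simpa [dist_eq_norm] using hb.dist_le_mul x y
          · simpa [dist_eq_norm] using ha.dist_le_mul x y
          · exact hN y
      _ = _ := by ring
  have hC : 0 ≤ ‖L‖ * (|M| * Cb + Ca * N) := by positivity
  refine ⟨⟨_, hC⟩, LipschitzWith.of_dist_le_mul fun x y => ?_⟩
  simp only [dist_eq_norm]
  by_cases hx : x ∈ tsupport b
  · exact key x hx y
  by_cases hy : y ∈ tsupport b
  · rw [norm_sub_rev, norm_sub_rev x y]
    exact key y hy x
  · rw [image_eq_zero_of_notMem_tsupport hx, image_eq_zero_of_notMem_tsupport hy]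
    simp only [map_zero, sub_self, norm_zero]
    exact mul_nonneg hC (norm_nonneg _)

/-- The (almost everywhere defined) divergence of a Lipschitz field. -/
def lipDiv (W : Pt d → Pt d) (x : Pt d) : ℝ :=
  ∑ j, lineDeriv ℝ (fun y => W y j) x (EuclideanSpace.single j 1)

theorem lipschitzWith_coord {W : Pt d → Pt d} {C : NNReal} (hW : LipschitzWith C W) (j : Fin d) :
    LipschitzWith C (fun y => W y j) := by
  refine LipschitzWith.of_dist_le_mul fun x y => le_trans ?_ (hW.dist_le_mul x y)
  rw [dist_eq_norm, dist_eq_norm, ← PiLp.sub_apply]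
  exact PiLp.norm_apply_le _ _

/-- The divergence theorem for Lipschitz fields. -/
theorem IsOutwardNormal.isNormalTrace_of_lipschitz (hK : IsOpen K)
    (hfin : surf d (frontier K) < ⊤) (hKfin : volume K < ⊤) (hn : IsOutwardNormal K n)
    {W : Pt d → Pt d} {C : NNReal} (hW : LipschitzWith C W) (hc : HasCompactSupport W) :
    HasWeakDiv K W (lipDiv W) ∧ IsNormalTrace K W (fun x => ⟪n x, W x⟫) := by
  have := isFiniteMeasure_bdry hfin
  have : IsFiniteMeasure (volume.restrict K) := ⟨by rwa [Measure.restrict_apply_univ]⟩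
  obtain ⟨N, hN⟩ := hc.exists_bound_of_continuous hW.continuous
  have hj := lipschitzWith_coord hW
  have hcj : ∀ j, HasCompactSupport fun y => W y j := fun j =>
    hc.comp_left (g := fun z : Pt d => z j) rfl
  have hDi : ∀ j, IntegrableOn
      (fun x => lineDeriv ℝ (fun y => W y j) x (EuclideanSpace.single j 1)) K := fun j =>
    ((hj j).memLp_lineDeriv (μ := volume.restrict K) _).integrable le_top
  have hWi : IntegrableOn W K :=
    Integrable.of_bound hW.continuous.aestronglyMeasurable N (.of_forall hN)
  have hnW : Integrable (fun x => ⟪n x, W x⟫) (bdry K) := by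
    refine Integrable.of_bound (hn.1.inner hW.continuous.aestronglyMeasurable) N ?_
    filter_upwards [hn.2.1] with x hx
    refine (norm_inner_le_norm _ _).trans ?_
    rw [hx, one_mul]
    exact hN x
  refine isNormalTrace_of_green hK hnW hWi (integrable_finsetSum _ fun j _ => hDi j)
    fun φ hφ => ?_
  obtain ⟨D, hD⟩ := hφ.1.lipschitzWith_of_hasCompactSupport hφ.2 (by simp)
  -- the divergence theorem for each of the functions `W_j φ`, in the direction `e_j`
  have key : ∀ j, ∫ x in K, (W x j * ⟪EuclideanSpace.single j (1 : ℝ), gradient φ x⟫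
      + lineDeriv ℝ (fun y => W y j) x (EuclideanSpace.single j 1) * φ x)
      = ∫ x, W x j * φ x * ⟪EuclideanSpace.single j (1 : ℝ), n x⟫ ∂(bdry K) := fun j => by
    obtain ⟨E, hE⟩ := exists_lipschitzWith_bilinear (ContinuousLinearMap.mul ℝ ℝ) (hj j) hD hφ.2
    have h := hn.integral_lineDeriv hfin hKfin hE hφ.2.mul_left (EuclideanSpace.single j 1)
    simp only [ContinuousLinearMap.mul_apply'] at h
    rw [← h]
    refine integral_congr_ae (ae_restrict_of_ae ?_)
    filter_upwards [(hj j).ae_lineDifferentiableAt (μ := volume) (EuclideanSpace.single j 1)]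
      with x hx
    have h1 : HasLineDerivAt ℝ φ ⟪EuclideanSpace.single j (1 : ℝ), gradient φ x⟫ x
        (EuclideanSpace.single j 1) := by
      rw [inner_gradient_eq_lineDeriv (contDiff_differentiable hφ.1 x)]
      exact (contDiff_differentiable hφ.1 x).lineDifferentiableAt.hasLineDerivAt
    have h2 : HasLineDerivAt ℝ (fun y => W y j * φ y) _ x (EuclideanSpace.single j 1) :=
      HasDerivAt.mul hx.hasLineDerivAt h1
    rw [h2.lineDeriv]
    simp only [zero_smul, add_zero]
    ring
  have hint : ∀ j, IntegrableOn (fun x => W x j * ⟪EuclideanSpace.single j (1 : ℝ), gradient φ x⟫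
      + lineDeriv ℝ (fun y => W y j) x (EuclideanSpace.single j 1) * φ x) K := fun j => by
    refine Integrable.add ?_ (hφ.integrable_mul (hDi j))
    obtain ⟨C', hC'⟩ := hφ.exists_bound_gradient
    refine Integrable.mul_bdd (c := C') (((hj j).continuous.integrable_of_hasCompactSupport
      (hcj j)).integrableOn)
      (aestronglyMeasurable_const.inner (continuous_gradient hφ.1).aestronglyMeasurable)
      (.of_forall fun x => ?_)
    have := norm_inner_le_norm (𝕜 := ℝ) (EuclideanSpace.single j (1 : ℝ)) (gradient φ x)
    simp only [PiLp.norm_single, norm_one, one_mul] at this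
    exact this.trans (hC' x)
  have hint' : ∀ j, Integrable
      (fun x => W x j * φ x * ⟪EuclideanSpace.single j (1 : ℝ), n x⟫) (bdry K) := fun j => by
    obtain ⟨E, hE⟩ := exists_lipschitzWith_bilinear (ContinuousLinearMap.mul ℝ ℝ) (hj j) hD hφ.2
    obtain ⟨B, hB⟩ := HasCompactSupport.exists_bound_of_continuous (hφ.2.mul_left (f := fun y => W y j))
      (by exact hE.continuous)
    refine Integrable.of_bound ((by exact hE.continuous.aestronglyMeasurable :
      AEStronglyMeasurable (fun x => W x j * φ x) _).mul (aestronglyMeasurable_const.inner hn.1)) B ?_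
    filter_upwards [hn.2.1] with x hx
    have h1 := norm_inner_le_norm (𝕜 := ℝ) (EuclideanSpace.single j (1 : ℝ)) (n x)
    simp only [PiLp.norm_single, norm_one, one_mul, hx] at h1
    rw [norm_mul]
    calc _ ≤ B * 1 := mul_le_mul (hB x) h1 (norm_nonneg _) ((norm_nonneg _).trans (hB x))
      _ = B := mul_one B
  calc ∫ x in K, (⟪W x, gradient φ x⟫ + lipDiv W x * φ x)
      = ∫ x in K, ∑ j, (W x j * ⟪EuclideanSpace.single j (1 : ℝ), gradient φ x⟫
          + lineDeriv ℝ (fun y => W y j) x (EuclideanSpace.single j 1) * φ x) := by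
        congr 1 with x
        rw [Finset.sum_add_distrib, lipDiv, Finset.sum_mul]
        congr 1
        rw [PiLp.inner_apply]
        refine Finset.sum_congr rfl fun j _ => ?_
        simp only [EuclideanSpace.inner_single_left, map_one, one_mul, RCLike.inner_apply,
          conj_trivial]
        ring
    _ = ∑ j, ∫ x, W x j * φ x * ⟪EuclideanSpace.single j (1 : ℝ), n x⟫ ∂(bdry K) := by
        rw [integral_finsetSum _ fun j _ => hint j]
        exact Finset.sum_congr rfl fun j _ => key j
    _ = ∫ x, ∑ j, W x j * φ x * ⟪EuclideanSpace.single j (1 : ℝ), n x⟫ ∂(bdry K) :=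
        (integral_finsetSum _ fun j _ => hint' j).symm
    _ = ∫ x, ⟪n x, W x⟫ * φ x ∂(bdry K) := by
        congr 1 with x
        rw [PiLp.inner_apply, Finset.sum_mul]
        refine Finset.sum_congr rfl fun j _ => ?_
        simp only [EuclideanSpace.inner_single_left, map_one, one_mul, RCLike.inner_apply,
          conj_trivial]
        ring

end LipschitzFields

/-! ### The diffusive flux -/

section Conormal

variable {d : ℕ} {K : Set (Pt d)} {n : Pt d → Pt d} {A : Pt d → (Pt d →L[ℝ] Pt d)}

theorem exists_lipschitz_extension {C : NNReal} (hA : LipschitzOnWith C A K) :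
    ∃ (B : Pt d → (Pt d →L[ℝ] Pt d)) (C' : NNReal), LipschitzWith C' B ∧ EqOn A B K := by
  obtain ⟨B, hB, he⟩ := hA.extend_finite_dimension
  exact ⟨B, _, hB, he⟩

theorem sided_eq_of_eqOn {B : Pt d → (Pt d →L[ℝ] Pt d)} (hB : Continuous B) (he : EqOn A B K)
    {x : Pt d} (hx : x ∈ closure K) : sided K A x = B x :=
  extendFrom_eq hx ((hB.continuousAt.tendsto.mono_left nhdsWithin_le_nhds).congr'
    (eventually_mem_nhdsWithin.mono fun _ hy => (he hy).symm))

theorem volume_lt_top_of_isBounded (hb : Bornology.IsBounded K) : volume K < ⊤ :=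
  hb.measure_lt_top

/-- The Green identity for the flux of a smooth field through a Lipschitz coefficient. -/
theorem IsOutwardNormal.green_smooth (hK : IsOpen K) (hb : Bornology.IsBounded K)
    (hfin : surf d (frontier K) < ⊤) (hn : IsOutwardNormal K n)
    {B : Pt d → (Pt d →L[ℝ] Pt d)} {C : NNReal} (hB : LipschitzWith C B)
    {F : Pt d → Pt d} (hF : ContDiff ℝ ∞ F) {ε : Pt d → ℝ}
    (hε : HasWeakDiv K (fun x => B x (F x)) ε) {φ : Pt d → ℝ} (hφ : IsTest φ) :
    ∫ x in K, (⟪B x (F x), gradient φ x⟫ + ε x * φ x) =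
      ∫ x, ⟪n x, B x (F x)⟫ * φ x ∂(bdry K) := by
  obtain ⟨χ, hχ, hχ1⟩ := exists_isTest_eventuallyEq_one hb
  have hχF : ContDiff ℝ ∞ fun x => χ x • F x := hχ.1.smul hF
  have hχc : HasCompactSupport fun x => χ x • F x := hχ.2.smul_right
  obtain ⟨D, hD⟩ := hχF.lipschitzWith_of_hasCompactSupport hχc (by simp)
  obtain ⟨E, hE⟩ := exists_lipschitzWith_bilinear (ContinuousLinearMap.id ℝ _) hB hD hχc
  have hχK : ∀ x ∈ closure K, χ x = 1 := fun x hx => (hχ1 x hx).self_of_nhds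
  have heq : EqOn (fun x => B x (χ x • F x)) (fun x => B x (F x)) (closure K) := fun x hx => by
    simp [hχK x hx]
  have hWc : HasCompactSupport fun x => B x (χ x • F x) :=
    hχc.mono fun x hx => by
      rw [Function.mem_support] at hx ⊢
      exact fun h => hx (by rw [h, map_zero])
  have hN := (hn.isNormalTrace_of_lipschitz hK hfin (volume_lt_top_of_isBounded hb) hE hWc).2
  have hN' : IsNormalTrace K (fun x => B x (F x)) (fun x => ⟪n x, B x (F x)⟫) := by
    refine hN.congr hK (fun x hx => heq (subset_closure hx)) ?_
    filter_upwards [ae_restrict_mem isClosed_frontier.measurableSet] with x hx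
    have := heq hx.1
    simp only at this
    simp [this]
  exact (hN'.green hK hε).2 φ hφ

/-- The diffusive flux of the scheme is the normal trace of the field `A∇f`. -/
theorem IsConormalTrace.isNormalTrace (hK : IsOpen K) (hb : Bornology.IsBounded K)
    (hfin : surf d (frontier K) < ⊤) (hn : IsOutwardNormal K n) {C : NNReal}
    (hA : LipschitzOnWith C A K) {f q : Pt d → ℝ}
    (hf : MemLp (weakGrad K f) 2 (volume.restrict K)) (h : IsConormalTrace K n A f q) :
    IsNormalTrace K (fun x => A x (weakGrad K f x)) q := by
  have := isFiniteMeasure_bdry hfin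
  have : IsFiniteMeasure (volume.restrict K) :=
    ⟨by rw [Measure.restrict_apply_univ]; exact hb.measure_lt_top⟩
  obtain ⟨B, C', hB, he⟩ := exists_lipschitz_extension hA
  obtain ⟨F, G, ε, δ, hF, hG, hε, hδ, hδi, hF1, hε1, hFG, hq⟩ := h
  obtain ⟨M, hM⟩ := hb.isCompact_closure.exists_bound_of_continuousOn hB.continuous.continuousOn
  have hKmem : ∀ᵐ x ∂(volume.restrict K), x ∈ K := ae_restrict_mem hK.measurableSet
  have hbmem : ∀ᵐ x ∂(bdry K), x ∈ frontier K := ae_restrict_mem isClosed_frontier.measurableSet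
  have hBm : ∀ {μ : Measure (Pt d)} {g : Pt d → Pt d}, AEStronglyMeasurable g μ →
      AEStronglyMeasurable (fun x => B x (g x)) μ := fun {μ g} hg =>
    (ContinuousLinearMap.id ℝ (Pt d →L[ℝ] Pt d)).aestronglyMeasurable_comp₂
      hB.continuous.aestronglyMeasurable hg
  have hBi : ∀ {μ : Measure (Pt d)} {g : Pt d → Pt d}, Integrable g μ →
      (∀ᵐ x ∂μ, x ∈ closure K) → Integrable (fun x => B x (g x)) μ := fun {μ g} hg hμ => by
    refine (hg.norm.const_mul M).mono' (hBm hg.1) ?_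
    filter_upwards [hμ] with x hx
    exact (B x).le_of_opNorm_le (hM x hx) _
  have hclK : ∀ᵐ x ∂(volume.restrict K), x ∈ closure K := hKmem.mono fun x hx => subset_closure hx
  have hclb : ∀ᵐ x ∂(bdry K), x ∈ closure K := hbmem.mono fun x hx => hx.1
  have hFi : ∀ {μ : Measure (Pt d)} [IsFiniteMeasure μ] (k : ℕ), (∀ᵐ x ∂μ, x ∈ closure K) →
      Integrable (F k) μ := fun {μ} _ k hμ => by
    obtain ⟨N, hN⟩ := hb.isCompact_closure.exists_bound_of_continuousOn
      (hF k).continuous.continuousOn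
    exact Integrable.of_bound (hF k).continuous.aestronglyMeasurable N (hμ.mono fun x hx => hN x hx)
  have hni : ∀ {g : Pt d → Pt d}, Integrable g (bdry K) →
      Integrable (fun x => ⟪n x, g x⟫) (bdry K) := fun {g} hg => by
    refine hg.norm.mono' (hn.1.inner hg.1) ?_
    filter_upwards [hn.2.1] with x hx
    simpa [hx] using norm_inner_le_norm (𝕜 := ℝ) (n x) (g x)
  have hf1 : Integrable (weakGrad K f) (volume.restrict K) := hf.integrable one_le_two
  have hG1 : Integrable G (bdry K) := hG.integrable one_le_two
  have hN : IsNormalTrace K (fun x => B x (weakGrad K f x)) (fun x => ⟪n x, B x (G x)⟫) := by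
    refine (isNormalTrace_of_green hK (hni (hBi hG1 hclb)) (hBi hf1 hclK) hδi fun φ hφ => ?_).2
    obtain ⟨N, hN⟩ := hφ.exists_bound
    obtain ⟨N', hN'⟩ := hφ.exists_bound_gradient
    have h1 : Tendsto (fun k => ∫ x in K, ⟪B x (F k x), gradient φ x⟫) atTop
        (𝓝 (∫ x in K, ⟪B x (weakGrad K f x), gradient φ x⟫)) := by
      refine tendsto_integral_of_le_mul_L2 (w := fun _ => M * N') (g := F) (g₀ := weakGrad K f)
        (fun k => hφ.integrable_inner_gradient (hBi (hFi k hclK) hclK))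
        (hφ.integrable_inner_gradient (hBi hf1 hclK)) (memLp_const _)
        (fun k => (hFi k hclK).1.sub hf1.1) hF1 fun k => ?_
      filter_upwards [hclK] with x hx
      rw [← inner_sub_left, ← map_sub]
      calc _ ≤ ‖B x (F k x - weakGrad K f x)‖ * ‖gradient φ x‖ := norm_inner_le_norm _ _
        _ ≤ M * ‖F k x - weakGrad K f x‖ * N' := by
            gcongr
            · exact mul_nonneg ((norm_nonneg _).trans (hM x hx)) (norm_nonneg _)
            · exact (B x).le_of_opNorm_le (hM x hx) _
            · exact hN' x
        _ = M * N' * ‖F k x - weakGrad K f x‖ := by ring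
        _ ≤ _ := by gcongr; exact le_abs_self _
    have h2 : Tendsto (fun k => ∫ x in K, ε k x * φ x) atTop (𝓝 (∫ x in K, δ x * φ x)) :=
      tendsto_integral_mul_of_L1 hφ.1.continuous.aestronglyMeasurable hN (fun k => (hε k).2) hδi hε1
    have h3 : Tendsto (fun k => ∫ x, ⟪n x, B x (F k x)⟫ * φ x ∂(bdry K)) atTop
        (𝓝 (∫ x, ⟪n x, B x (G x)⟫ * φ x ∂(bdry K))) := by
      refine tendsto_integral_of_le_mul_L2 (w := fun _ => M * N) (g := F) (g₀ := G)
        (fun k => hφ.integrable_mul (hni (hBi (hFi k hclb) hclb)))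
        (hφ.integrable_mul (hni (hBi hG1 hclb))) (memLp_const _)
        (fun k => (hFi k hclb).1.sub hG1.1) hFG fun k => ?_
      filter_upwards [hclb, hn.2.1] with x hx hnx
      rw [← sub_mul, ← inner_sub_right, ← map_sub, norm_mul]
      calc _ ≤ ‖n x‖ * ‖B x (F k x - G x)‖ * ‖φ x‖ := by
            gcongr; exact norm_inner_le_norm _ _
        _ ≤ 1 * (M * ‖F k x - G x‖) * N := by
            gcongr
            · exact mul_nonneg zero_le_one
                (mul_nonneg ((norm_nonneg _).trans (hM x hx)) (norm_nonneg _))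
            · exact hnx.le
            · exact (B x).le_of_opNorm_le (hM x hx) _
            · exact hN x
        _ = M * N * ‖F k x - G x‖ := by ring
        _ ≤ _ := by gcongr; exact le_abs_self _
    have h12 := h1.add h2
    rw [← integral_add (hφ.integrable_inner_gradient (hBi hf1 hclK)) (hφ.integrable_mul hδi)] at h12
    refine tendsto_nhds_unique (h12.congr fun k => ?_) h3
    rw [← integral_add (hφ.integrable_inner_gradient (hBi (hFi k hclK) hclK))
      (hφ.integrable_mul (hε k).2)]
    exact hn.green_smooth hK hb hfin hB (hF k)
      ((hε k).1.congr hK fun x hx => by simp only [he hx]) hφ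
  refine hN.congr hK (fun x hx => by simp only [he hx]) ?_
  filter_upwards [hq, hclb] with x hx hcl
  rw [hx, sided_eq_of_eqOn hB.continuous he hcl]

/-- A symmetric nonnegative coefficient produces no diffusive flux in the directions in which it
degenerates: `nᵀAn = 0` forces `An = 0`. -/
theorem inner_eq_zero_of_inner_self_eq_zero {T : Pt d →L[ℝ] Pt d}
    (hs : ∀ ξ η : Pt d, ⟪T ξ, η⟫ = ⟪ξ, T η⟫) (hp : ∀ ξ : Pt d, 0 ≤ ⟪ξ, T ξ⟫) {v : Pt d}
    (hv : ⟪v, T v⟫ = 0) (w : Pt d) : ⟪v, T w⟫ = 0 := by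
  set a := ⟪w, T w⟫ with ha
  set b := ⟪v, T w⟫ with hb
  have h : ∀ t : ℝ, 0 ≤ 2 * t * b + t ^ 2 * a := fun t => by
    have := hp (v + t • w)
    have e : ⟪w, T v⟫ = b := by rw [hb, ← hs, real_inner_comm]
    simp only [map_add, map_smul, inner_add_left, inner_add_right, inner_smul_left,
      inner_smul_right, hv, ← hb, ← ha, e, conj_trivial] at this
    linarith
  have ha0 : 0 ≤ a := hp w
  have h1 := h (-b / (a + 1))
  have e : 2 * (-b / (a + 1)) * b + (-b / (a + 1)) ^ 2 * a = -(b ^ 2 * (a + 2) / (a + 1) ^ 2) := by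
    field_simp; ring
  rw [e] at h1
  have h2 : 0 ≤ b ^ 2 * (a + 2) / (a + 1) ^ 2 := by positivity
  have h3 : b ^ 2 * (a + 2) / (a + 1) ^ 2 = 0 := by linarith
  have h4 : (a + 1) ^ 2 ≠ 0 := by positivity
  have h5 : a + 2 ≠ 0 := by positivity
  simpa [h4, h5] using h3

/-- Algebraic identities and inequalities for a continuous coefficient pass from almost every point
of an open set to the one-sided values on its closure. -/
theorem sided_symm_nonneg (hK : IsOpen K) {C : NNReal} (hA : LipschitzOnWith C A K)
    (hs : ∀ᵐ x ∂(volume.restrict K), ∀ ξ η : Pt d, ⟪A x ξ, η⟫ = ⟪ξ, A x η⟫)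
    (hp : ∀ᵐ x ∂(volume.restrict K), ∀ ξ : Pt d, 0 ≤ ⟪ξ, A x ξ⟫) {x : Pt d} (hx : x ∈ closure K) :
    (∀ ξ η : Pt d, ⟪sided K A x ξ, η⟫ = ⟪ξ, sided K A x η⟫) ∧
      ∀ ξ : Pt d, 0 ≤ ⟪ξ, sided K A x ξ⟫ := by
  obtain ⟨B, C', hB, he⟩ := exists_lipschitz_extension hA
  rw [sided_eq_of_eqOn hB.continuous he hx]
  let S : Set (Pt d) := {x | (∀ ξ η : Pt d, ⟪B x ξ, η⟫ = ⟪ξ, B x η⟫) ∧ ∀ ξ : Pt d, 0 ≤ ⟪ξ, B x ξ⟫}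
  have hc : ∀ ξ, Continuous fun x => B x ξ := fun ξ => hB.continuous.clm_apply continuous_const
  have hS : IsClosed S := by
    simp only [S, ofPred_and, ofPred_forall]
    refine IsClosed.inter (isClosed_iInter fun ξ => isClosed_iInter fun η => ?_)
      (isClosed_iInter fun ξ => ?_)
    · exact isClosed_eq ((hc ξ).inner continuous_const) (continuous_const.inner (hc η))
    · exact isClosed_le continuous_const (continuous_const.inner (hc ξ))
  have hae : ∀ᵐ y ∂(volume.restrict K), y ∈ S := by
    filter_upwards [hs, hp, ae_restrict_mem hK.measurableSet] with y h1 h2 h3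
    rw [he h3] at h1 h2
    exact ⟨h1, h2⟩
  have hsub : K ⊆ S := by
    have h0 : volume (K ∩ Sᶜ) = 0 := by
      rw [ae_iff, Measure.restrict_apply' hK.measurableSet] at hae
      rw [inter_comm]
      exact hae
    have := (hK.inter hS.isOpen_compl).eq_empty_of_measure_zero h0
    intro y hy
    by_contra hyS
    exact (this ▸ (⟨hy, hyS⟩ : y ∈ K ∩ Sᶜ) : y ∈ (∅ : Set (Pt d)))
  exact closure_minimal hsub hS hx

end Conormal

/-! ### The advective flux -/

section Advective

variable {d : ℕ} {K : Set (Pt d)} {u : Pt d → Pt d} {δ b f t : Pt d → ℝ}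

theorem integrable_inner_of_memLp {X : Type*} [MeasurableSpace X] {μ : Measure X}
    {v w : X → Pt d} (hv : MemLp v 2 μ) (hw : MemLp w 2 μ) :
    Integrable (fun x => ⟪v x, w x⟫) μ :=
  (hv.norm.integrable_mul hw.norm).mono' (hv.1.inner hw.1)
    (.of_forall fun _ => norm_inner_le_norm _ _)

/-- The Green identity for `T(f) u`, where `T` is bounded with bounded derivative. Boundedness of `T`
makes up for the fact that the normal trace `b` of `u` is merely integrable: the boundary values of
`T(ψ_k)`, with smooth `ψ_k → f`, converge boundedly almost everywhere along a subsequence. -/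
theorem IsNormalTrace.green_truncated (hK : IsOpen K) (hb : Bornology.IsBounded K)
    (hu : MemLp u 2 (volume.restrict K))
    (hδ : HasWeakDiv K u δ) (hδ2 : MemLp δ 2 (volume.restrict K)) (hub : IsNormalTrace K u b)
    (hf : MemLp f 2 (volume.restrict K)) (hf' : MemLp (weakGrad K f) 2 (volume.restrict K))
    (ht : IsTrace K f t) {T : ℝ → ℝ} (hT : ContDiff ℝ ∞ T) {M : ℝ} (hM : ∀ s, ‖T s‖ ≤ M)
    (hT' : ∀ s, ‖deriv T s‖ ≤ 1) {φ : Pt d → ℝ} (hφ : IsTest φ) :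
    ∫ x in K, (T (f x) * ⟪u x, gradient φ x⟫ + deriv T (f x) * ⟪u x, weakGrad K f x⟫ * φ x
      + T (f x) * (δ x * φ x)) = ∫ x, b x * (T (t x) * φ x) ∂(bdry K) := by
  have : IsFiniteMeasure (volume.restrict K) :=
    ⟨by rw [Measure.restrict_apply_univ]; exact hb.measure_lt_top⟩
  obtain ⟨ht2, ψ, hψ, hψf, hψg, hψt⟩ := ht
  have hM0 : 0 ≤ M := (norm_nonneg _).trans (hM 0)
  have hTc : Continuous T := hT.continuous
  have hTd : Continuous (deriv T) := hT.continuous_deriv (by simp)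
  obtain ⟨N, hN⟩ := hφ.exists_bound
  obtain ⟨N', hN'⟩ := hφ.exists_bound_gradient
  have hN0 : 0 ≤ N := (norm_nonneg _).trans (hN 0)
  have hu1 : Integrable u (volume.restrict K) := hu.integrable one_le_two
  have hδ1 : Integrable δ (volume.restrict K) := hδ2.integrable one_le_two
  have hφm : ∀ {μ : Measure (Pt d)}, AEStronglyMeasurable φ μ := hφ.1.continuous.aestronglyMeasurable
  obtain ⟨n₁, hn₁, hae₁⟩ := exists_subseq_tendsto_ae_of_L2
    (fun k => (hψ k).continuous.aestronglyMeasurable) hf.1 hψf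
  obtain ⟨n₂, hn₂, hae₂⟩ := exists_subseq_tendsto_ae_of_L2
    (fun k => (hψ (n₁ k)).continuous.aestronglyMeasurable) ht2.1
    (hψt.comp hn₁.tendsto_atTop)
  set m : ℕ → ℕ := fun k => n₁ (n₂ k) with hm
  have hmt : Tendsto m atTop atTop := hn₁.tendsto_atTop.comp hn₂.tendsto_atTop
  have haeK : ∀ᵐ x ∂(volume.restrict K), Tendsto (fun k => ψ (m k) x) atTop (𝓝 (f x)) :=
    hae₁.mono fun x hx => hx.comp hn₂.tendsto_atTop
  -- the part of the integrand which converges boundedly, for a given approximation `p` of `f`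
  let H : (Pt d → ℝ) → Pt d → ℝ := fun p x => T (p x) * ⟪u x, gradient φ x⟫
    + deriv T (p x) * ⟪u x, weakGrad K f x⟫ * φ x + T (p x) * (δ x * φ x)
  have hug : Integrable (fun x => ⟪u x, gradient φ x⟫) (volume.restrict K) :=
    hφ.integrable_inner_gradient hu1
  have huf : Integrable (fun x => ⟪u x, weakGrad K f x⟫) (volume.restrict K) :=
    integrable_inner_of_memLp hu hf'
  have hHb : ∀ p x, ‖H p x‖ ≤ M * ‖⟪u x, gradient φ x⟫‖ + ‖⟪u x, weakGrad K f x⟫‖ * N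
      + M * ‖δ x * φ x‖ := fun p x => by
    refine (norm_add_le _ _).trans (add_le_add ((norm_add_le _ _).trans (add_le_add ?_ ?_)) ?_)
    · rw [norm_mul]; gcongr; exact hM _
    · rw [norm_mul, norm_mul]
      calc _ ≤ 1 * ‖⟪u x, weakGrad K f x⟫‖ * N := by gcongr; exacts [hT' _, hN x]
        _ = _ := by rw [one_mul]
    · rw [norm_mul]; gcongr; exact hM _
  have hbi : Integrable (fun x => M * ‖⟪u x, gradient φ x⟫‖ + ‖⟪u x, weakGrad K f x⟫‖ * N
      + M * ‖δ x * φ x‖) (volume.restrict K) :=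
    ((hug.norm.const_mul M).add (huf.norm.mul_const N)).add
      ((hφ.integrable_mul hδ1).norm.const_mul M)
  have hHm : ∀ {p : Pt d → ℝ}, AEStronglyMeasurable p (volume.restrict K) →
      AEStronglyMeasurable (H p) (volume.restrict K) := fun {p} hp =>
    (((hTc.comp_aestronglyMeasurable hp).mul hug.1).add
      (((hTd.comp_aestronglyMeasurable hp).mul huf.1).mul hφm)).add
      ((hTc.comp_aestronglyMeasurable hp).mul (hδ1.1.mul hφm))
  have hψm : ∀ k, AEStronglyMeasurable (ψ k) (volume.restrict K) := fun k =>
    (hψ k).continuous.aestronglyMeasurable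
  have h1 : Tendsto (fun k => ∫ x in K, H (ψ (m k)) x) atTop (𝓝 (∫ x in K, H f x)) := by
    refine tendsto_integral_of_dominated_convergence _ (fun k => hHm (hψm _)) hbi
      (fun k => .of_forall (hHb _)) ?_
    filter_upwards [haeK] with x hx
    have a1 := (hTc.tendsto (f x)).comp hx
    have a2 := (hTd.tendsto (f x)).comp hx
    exact ((a1.mul_const _).add ((a2.mul_const _).mul_const _)).add (a1.mul_const _)
  -- the remaining part, which tends to zero
  let R : ℕ → Pt d → ℝ := fun k x =>
    deriv T (ψ k x) * ⟪u x, gradient (ψ k) x - weakGrad K f x⟫ * φ x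
  have hgψ : ∀ k, MemLp (gradient (ψ k)) 2 (volume.restrict K) := fun k => by
    obtain ⟨B, hB⟩ := hb.isCompact_closure.exists_bound_of_continuousOn
      (continuous_gradient (hψ k)).continuousOn
    exact MemLp.of_bound (continuous_gradient (hψ k)).aestronglyMeasurable B
      ((ae_restrict_mem hK.measurableSet).mono fun x hx => hB x (subset_closure hx))
  have hRb : ∀ k x, ‖R k x‖ ≤ ‖N * ‖u x‖‖ * ‖gradient (ψ k) x - weakGrad K f x‖ := fun k x => by
    simp only [R, norm_mul, norm_norm, Real.norm_of_nonneg hN0]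
    calc _ ≤ 1 * (‖u x‖ * ‖gradient (ψ k) x - weakGrad K f x‖) * N := by
          gcongr
          exacts [hT' _, norm_inner_le_norm _ _, hN x]
      _ = _ := by ring
  have hRi : ∀ k, Integrable (R k) (volume.restrict K) := fun k => by
    refine Integrable.mul_bdd (c := N) ?_ hφm (.of_forall hN)
    exact Integrable.bdd_mul (c := 1) (integrable_inner_of_memLp hu ((hgψ k).sub hf'))
      (hTd.comp_aestronglyMeasurable (hψm k)) (.of_forall fun x => hT' _)
  have h2 : Tendsto (fun k => ∫ x in K, R (m k) x) atTop (𝓝 0) := by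
    have := tendsto_integral_of_le_mul_L2 (H := fun k => R (m k)) (H₀ := 0)
      (w := fun x => N * ‖u x‖) (g := fun k => gradient (ψ (m k))) (g₀ := weakGrad K f)
      (fun k => hRi _) (integrable_zero _ _ _) (hu.norm.const_mul N)
      (fun k => (hgψ _).1.sub hf'.1) (hψg.comp hmt)
      (fun k => .of_forall fun x => by simpa using hRb (m k) x)
    simpa using this
  have h3 : Tendsto (fun k => ∫ x, b x * (T (ψ (m k) x) * φ x) ∂(bdry K)) atTop
      (𝓝 (∫ x, b x * (T (t x) * φ x) ∂(bdry K))) := by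
    refine tendsto_integral_of_dominated_convergence (fun x => ‖b x‖ * (M * N)) (fun k => ?_)
      (hub.1.norm.mul_const _) (fun k => .of_forall fun x => ?_) ?_
    · exact hub.1.1.mul ((hTc.comp (hψ _).continuous).aestronglyMeasurable.mul hφm)
    · rw [norm_mul, norm_mul]
      gcongr
      exacts [hM _, hN x]
    · filter_upwards [hae₂] with x hx
      exact (((hTc.tendsto _).comp hx).mul_const _).const_mul _
  have h12 := h1.add h2
  rw [add_zero] at h12
  refine tendsto_nhds_unique (h12.congr fun k => ?_) h3
  rw [← integral_add (Integrable.mono' hbi (hHm (hψm _)) (.of_forall (hHb _))) (hRi _)]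
  have hTψ : ContDiff ℝ ∞ fun x => T (ψ (m k) x) := hT.comp (hψ _)
  rw [← (hub.green hK hδ).2 _ (hφ.mul_left hTψ)]
  congr 1 with x
  rw [gradient_mul (contDiff_differentiable hTψ x) (contDiff_differentiable hφ.1 x),
    gradient_comp (hT.differentiable (by simp) _).hasDerivAt
      (contDiff_differentiable (hψ (m k)) x)]
  simp only [H, R, inner_add_right, inner_sub_right, inner_smul_right]
  ring

/-- The advective flux: if `f` has the trace `t` and `u` the integrable normal trace `b`, then `b t`
is the normal trace of `f u`, and the divergence of `f u` obeys the product rule. The proof truncates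
by `s ↦ m sin (s / m)`, which is smooth, bounded, and at most `|s|` with derivative at most `1`. -/
theorem IsNormalTrace.smul_of_isTrace (hK : IsOpen K) (hb : Bornology.IsBounded K)
    (hu : MemLp u 2 (volume.restrict K))
    (hδ : HasWeakDiv K u δ) (hδ2 : MemLp δ 2 (volume.restrict K)) (hub : IsNormalTrace K u b)
    (hf : MemLp f 2 (volume.restrict K)) (hf' : MemLp (weakGrad K f) 2 (volume.restrict K))
    (ht : IsTrace K f t) (hbt : Integrable (fun x => b x * t x) (bdry K)) :
    HasWeakDiv K (fun x => f x • u x) (fun x => ⟪u x, weakGrad K f x⟫ + f x * δ x) ∧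
      IsNormalTrace K (fun x => f x • u x) (fun x => b x * t x) := by
  have hfδ : Integrable (fun x => f x * δ x) (volume.restrict K) := hf.integrable_mul hδ2
  have huf : Integrable (fun x => ⟪u x, weakGrad K f x⟫) (volume.restrict K) :=
    integrable_inner_of_memLp hu hf'
  have hfu : Integrable (fun x => f x • u x) (volume.restrict K) :=
    (hf.norm.integrable_mul hu.norm).mono' (hf.1.smul hu.1) (.of_forall fun _ => (norm_smul _ _).le)
  refine isNormalTrace_of_green hK hbt hfu (huf.add hfδ) fun φ hφ => ?_
  let T : ℕ → ℝ → ℝ := fun k s => ((k : ℝ) + 1) * Real.sin (s / ((k : ℝ) + 1))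
  have hpos : ∀ k : ℕ, 0 < (k : ℝ) + 1 := fun k => by positivity
  have hTs : ∀ k, ContDiff ℝ ∞ (T k) := fun k =>
    contDiff_const.mul (Real.contDiff_sin.comp (contDiff_id.div_const _))
  have hTd : ∀ k s, HasDerivAt (T k) (Real.cos (s / ((k : ℝ) + 1))) s := fun k s => by
    have h := ((Real.hasDerivAt_sin (s / ((k : ℝ) + 1))).comp s
      ((hasDerivAt_id s).div_const ((k : ℝ) + 1))).const_mul ((k : ℝ) + 1)
    refine h.congr_deriv ?_
    rw [mul_left_comm, mul_one_div_cancel (hpos k).ne', mul_one]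
  have hTle : ∀ k s, ‖T k s‖ ≤ ‖s‖ := fun k s => by
    have := Real.abs_sin_le_abs (x := s / ((k : ℝ) + 1))
    simp only [T, Real.norm_eq_abs, abs_mul, abs_div, abs_of_pos (hpos k)] at this ⊢
    rwa [le_div_iff₀' (hpos k)] at this
  have hTb : ∀ k s, ‖T k s‖ ≤ (k : ℝ) + 1 := fun k s => by
    simp only [T, Real.norm_eq_abs, abs_mul, abs_of_pos (hpos k)]
    exact mul_le_of_le_one_right (hpos k).le (Real.abs_sin_le_one _)
  have hT1 : ∀ k s, ‖deriv (T k) s‖ ≤ 1 := fun k s => by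
    rw [(hTd k s).deriv]; exact Real.abs_cos_le_one _
  have hdiv : ∀ s : ℝ, Tendsto (fun k : ℕ => s / ((k : ℝ) + 1)) atTop (𝓝 0) := fun s => by
    simpa [div_eq_mul_inv] using
      (tendsto_one_div_add_atTop_nhds_zero_nat (𝕜 := ℝ)).const_mul s
  have hcos : ∀ s, Tendsto (fun k => deriv (T k) s) atTop (𝓝 1) := fun s => by
    have := (Real.continuous_cos.tendsto 0).comp (hdiv s)
    rw [Real.cos_zero] at this
    exact this.congr fun k => ((hTd k s).deriv).symm
  have hTlim : ∀ s, Tendsto (fun k => T k s) atTop (𝓝 s) := fun s => by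
    rcases eq_or_ne s 0 with rfl | hs
    · simp [T]
    have hd : Tendsto (fun x : ℝ => x⁻¹ * Real.sin x) (𝓝[≠] 0) (𝓝 1) := by
      have := (Real.hasDerivAt_sin 0).tendsto_slope_zero
      simpa using this
    have h0 : Tendsto (fun k : ℕ => s / ((k : ℝ) + 1)) atTop (𝓝[≠] 0) :=
      tendsto_nhdsWithin_iff.2 ⟨hdiv s, .of_forall fun k => div_ne_zero hs (hpos k).ne'⟩
    have := (hd.comp h0).const_mul s
    rw [mul_one] at this
    refine this.congr fun k => ?_
    simp only [Function.comp_apply, T]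
    field_simp
  clear_value T
  obtain ⟨N, hN⟩ := hφ.exists_bound
  obtain ⟨N', hN'⟩ := hφ.exists_bound_gradient
  have hfg : Integrable (fun x => f x * ⟪u x, gradient φ x⟫) (volume.restrict K) := by
    refine (hφ.integrable_inner_gradient hfu).congr (.of_forall fun x => ?_)
    simp
  have hφm : ∀ {μ : Measure (Pt d)}, AEStronglyMeasurable φ μ :=
    hφ.1.continuous.aestronglyMeasurable
  have hum : AEStronglyMeasurable (fun x => ⟪u x, gradient φ x⟫) (volume.restrict K) :=
    hu.1.inner (continuous_gradient hφ.1).aestronglyMeasurable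
  have h1 : Tendsto (fun k => ∫ x in K, (T k (f x) * ⟪u x, gradient φ x⟫
      + deriv (T k) (f x) * ⟪u x, weakGrad K f x⟫ * φ x + T k (f x) * (δ x * φ x))) atTop
      (𝓝 (∫ x in K, (f x * ⟪u x, gradient φ x⟫ + 1 * ⟪u x, weakGrad K f x⟫ * φ x
        + f x * (δ x * φ x)))) := by
    refine tendsto_integral_of_dominated_convergence
      (fun x => ‖f x * ⟪u x, gradient φ x⟫‖ + ‖⟪u x, weakGrad K f x⟫ * φ x‖
        + ‖f x * δ x * φ x‖) (fun k => ?_) ((hfg.norm.add (hφ.integrable_mul huf).norm).add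
          (hφ.integrable_mul hfδ).norm) (fun k => .of_forall fun x => ?_) (.of_forall fun x => ?_)
    · have a1 := (hTs k).continuous.comp_aestronglyMeasurable hf.1
      have a2 := ((hTs k).continuous_deriv (by simp)).comp_aestronglyMeasurable hf.1
      exact ((a1.mul hum).add ((a2.mul huf.1).mul hφm)).add (a1.mul (hδ2.1.mul hφm))
    · refine (norm_add_le _ _).trans (add_le_add ((norm_add_le _ _).trans (add_le_add ?_ ?_)) ?_)
      · rw [norm_mul, norm_mul]; gcongr; exact hTle k _
      · rw [mul_assoc, norm_mul]
        exact mul_le_of_le_one_left (norm_nonneg _) (hT1 k _)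
      · rw [mul_assoc, norm_mul, norm_mul (f x)]; gcongr; exact hTle k _
    · exact (((hTlim _).mul_const _).add (((hcos _).mul_const _).mul_const _)).add
        ((hTlim _).mul_const _)
  have h2 : Tendsto (fun k => ∫ x, b x * (T k (t x) * φ x) ∂(bdry K)) atTop
      (𝓝 (∫ x, b x * (t x * φ x) ∂(bdry K))) := by
    refine tendsto_integral_of_dominated_convergence (fun x => ‖b x * t x * φ x‖) (fun k => ?_)
      (hφ.integrable_mul hbt).norm (fun k => .of_forall fun x => ?_) (.of_forall fun x => ?_)
    · exact hub.1.1.mul (((hTs k).continuous.comp_aestronglyMeasurable ht.1.1).mul hφm)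
    · rw [mul_assoc, norm_mul, norm_mul, norm_mul (b x), norm_mul (t x)]
      gcongr
      exact hTle k _
    · exact ((hTlim _).mul_const _).const_mul _
  have h12 := tendsto_nhds_unique (h1.congr fun k =>
    hub.green_truncated hK hb hu hδ hδ2 hf hf' ht (hTs k) (hTb k) (hT1 k) hφ) h2
  simp only [mul_assoc]
  rw [← h12]
  congr 1 with x
  simp only [inner_smul_left, conj_trivial]
  ring

end Advective

/-! ### Geometry of the mesh -/

section Geometry

variable {d : ℕ}

/-- A Lipschitz domain lies on one side of its boundary: boundary points are limits of exterior
points. -/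
theorem IsLipschitzDomain.frontier_subset {U : Set (Pt d)} (hU : IsLipschitzDomain U) :
    frontier U ⊆ closure (closure U)ᶜ := by
  intro x hx
  obtain ⟨ν, r, C, f, hν, hr, hf, hinv, hloc⟩ := hU.2 x hx
  have hxU : x ∉ U := (hU.1.frontier_eq ▸ hx).2
  have hfx : f x ≤ ⟪ν, x⟫ := by
    by_contra! h
    exact hxU ((hloc x (Metric.mem_ball_self hr)).2 h)
  have hsub : Metric.ball x r ∩ {y | f y < ⟪ν, y⟫} ⊆ (closure U)ᶜ := by
    have ho : IsOpen (Metric.ball x r ∩ {y | f y < ⟪ν, y⟫}) :=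
      Metric.isOpen_ball.inter (isOpen_lt hf.continuous (continuous_const.inner continuous_id))
    have hd : Disjoint (Metric.ball x r ∩ {y | f y < ⟪ν, y⟫}) U := by
      rw [disjoint_left]
      rintro y ⟨hy, hy'⟩ hyU
      exact absurd ((hloc y hy).1 hyU) (not_lt.2 (le_of_lt hy'))
    exact fun y hy hyc => disjoint_left.1 (hd.closure_right ho) hy hyc
  rw [Metric.mem_closure_iff]
  intro ε hε
  have ht : 0 < min ε r / 2 := by positivity
  have hdist : dist x (x + (min ε r / 2) • ν) = min ε r / 2 := by
    rw [dist_self_add_right, norm_smul, hν, mul_one, Real.norm_of_nonneg ht.le]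
  refine ⟨x + (min ε r / 2) • ν, hsub ⟨?_, ?_⟩, ?_⟩
  · rw [Metric.mem_ball, dist_comm, hdist]
    linarith [min_le_right ε r]
  · rw [mem_ofPred_eq, hinv, inner_add_right, inner_smul_right, real_inner_self_eq_norm_sq, hν]
    linarith
  · rw [hdist]
    linarith [min_le_left ε r]

/-- A set of finite surface measure is a Lebesgue null set. -/
theorem volume_eq_zero_of_surf_lt_top (hd : 1 ≤ d) {S : Set (Pt d)} (hS : surf d S < ⊤) :
    volume S = 0 := by
  rw [← EuclideanSpace.euclideanHausdorffMeasure_eq_volume]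
  exact (Measure.euclideanHausdorffMeasure_zero_or_top (show d - 1 < d by omega) S).resolve_right
    hS.ne

theorem ae_restrict_notMem {μ : Measure (Pt d)} {S T : Set (Pt d)} (hS : MeasurableSet S)
    (h : μ (S ∩ T) = 0) : ∀ᵐ x ∂(μ.restrict S), x ∉ T := by
  rw [ae_restrict_iff' hS, ae_iff]
  refine measure_mono_null (fun x hx => ?_) h
  simpa using hx

variable {ι : Type*} (P : Problem d) (M : Mesh P.Ω ι)

theorem isOpen_elem (i : ι) : IsOpen (M.elem i) := (M.lipschitz i).1

theorem volume_elem_lt_top (i : ι) : volume (M.elem i) < ⊤ := (M.bounded i).measure_lt_top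

theorem measurableSet_face (i j : ι) : MeasurableSet (face P M i j) :=
  (isClosed_frontier.inter isClosed_frontier).measurableSet

theorem measurableSet_bface (i : ι) : MeasurableSet (bface P M i) :=
  (isClosed_frontier.inter isClosed_frontier).measurableSet

theorem face_comm (i j : ι) : face P M i j = face P M j i := inter_comm _ _

theorem face_subset (i j : ι) : face P M i j ⊆ frontier (M.elem i) := inter_subset_left

theorem face_subset_right (i j : ι) : face P M i j ⊆ frontier (M.elem j) := inter_subset_right

theorem bface_subset (i : ι) : bface P M i ⊆ frontier (M.elem i) := inter_subset_left

theorem closure_elem_subset (i : ι) : closure (M.elem i) ⊆ closure P.Ω :=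
  closure_mono (M.subset i)

variable [Fintype ι]

theorem exists_mem_face_or_mem_bface (hΩ : IsOpen P.Ω) {i : ι} {x : Pt d}
    (hx : x ∈ frontier (M.elem i)) : (∃ j, i ≠ j ∧ x ∈ face P M i j) ∨ x ∈ bface P M i := by
  by_cases hxΩ : x ∈ frontier P.Ω
  · exact .inr ⟨hx, hxΩ⟩
  left
  have hxO : x ∈ P.Ω := by
    by_contra h
    exact hxΩ (hΩ.frontier_eq ▸ ⟨closure_elem_subset P M i hx.1, h⟩)
  have h1 : x ∈ closure (P.Ω ∩ (closure (M.elem i))ᶜ) :=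
    hΩ.inter_closure ⟨hxO, (M.lipschitz i).frontier_subset hx⟩
  have h2 : P.Ω ∩ (closure (M.elem i))ᶜ ⊆ ⋃ j ∈ {j | i ≠ j}, closure (M.elem j) := by
    rintro y ⟨hy, hyi⟩
    have : y ∈ ⋃ j, closure (M.elem j) := M.cover ▸ subset_closure hy
    obtain ⟨j, hj⟩ := mem_iUnion.1 this
    refine mem_iUnion₂.2 ⟨j, ?_, hj⟩
    rintro rfl
    exact hyi hj
  have h3 : IsClosed (⋃ j ∈ {j | i ≠ j}, closure (M.elem j)) :=
    (Set.toFinite _).isClosed_biUnion fun _ _ => isClosed_closure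
  obtain ⟨j, hij, hxj⟩ := mem_iUnion₂.1 (closure_minimal h2 h3 h1)
  refine ⟨j, hij, hx, (isOpen_elem P M j).frontier_eq ▸ ⟨hxj, fun h => ?_⟩⟩
  exact disjoint_left.1 ((M.disjoint i j hij).symm.closure_right (isOpen_elem P M j)) h hx.1

theorem volume_restrict_eq_sum (hd : 1 ≤ d) :
    volume.restrict P.Ω = ∑ i, volume.restrict (M.elem i) := by
  have h : P.Ω =ᵐ[volume] ⋃ i, M.elem i := by
    have h0 : volume (⋃ i, frontier (M.elem i)) = 0 :=
      measure_iUnion_null fun i => volume_eq_zero_of_surf_lt_top hd (M.finite_boundary i)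
    filter_upwards [measure_eq_zero_iff_ae_notMem.1 h0] with x hx
    refine propext ⟨fun hxΩ => ?_, fun hxU => ?_⟩
    · have : x ∈ ⋃ i, closure (M.elem i) := M.cover ▸ subset_closure hxΩ
      obtain ⟨i, hi⟩ := mem_iUnion.1 this
      by_contra hn
      refine hx (mem_iUnion.2 ⟨i, ?_⟩)
      rw [(isOpen_elem P M i).frontier_eq]
      exact ⟨hi, fun h => hn (mem_iUnion.2 ⟨i, h⟩)⟩
    · obtain ⟨i, hi⟩ := mem_iUnion.1 hxU
      exact M.subset i hi
  rw [Measure.restrict_congr_set h, Measure.restrict_iUnion (fun i j hij => M.disjoint i j hij)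
    fun i => (isOpen_elem P M i).measurableSet, Measure.sum_fintype]

open Classical in
/-- The boundary of an element consists of its interior faces and its part of `∂Ω`. -/
theorem integral_bdry_eq (hΩ : IsOpen P.Ω) (i : ι) {h : Pt d → ℝ}
    (hh : Integrable h (bdry (M.elem i))) :
    ∫ x, h x ∂(bdry (M.elem i)) =
      (∑ e ∈ M.faces with e.1 = i, ∫ x in face P M i e.2, h x ∂(surf d)) +
      (∑ e ∈ M.faces with e.2 = i, ∫ x in face P M i e.1, h x ∂(surf d)) +
      ∫ x in bface P M i, h x ∂(surf d) := by
  let s : Option ι → Set (Pt d) := fun o =>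
    o.elim (bface P M i) fun j => if i = j then ∅ else face P M i j
  have hsome : ∀ {j}, i ≠ j → s (some j) = face P M i j := fun {j} h => by simp [s, h]
  have hU : frontier (M.elem i) = ⋃ o, s o := by
    refine Subset.antisymm (fun x hx => ?_) (iUnion_subset fun o => ?_)
    · rcases exists_mem_face_or_mem_bface P M hΩ hx with ⟨j, hij, hj⟩ | hb
      · exact mem_iUnion.2 ⟨some j, by rwa [hsome hij]⟩
      · exact mem_iUnion.2 ⟨none, hb⟩
    · cases o with
      | none => exact bface_subset P M i
      | some j =>
        by_cases hij : i = j
        · simp [s, hij]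
        · rw [hsome hij]
          exact face_subset P M i j
  have hm : ∀ o, MeasurableSet (s o) := fun o => by
    cases o with
    | none => exact measurableSet_bface P M i
    | some j =>
      by_cases hij : i = j
      · simp [s, hij]
      · rw [hsome hij]; exact measurableSet_face P M i j
  have hbf : ∀ {j}, i ≠ j → surf d (face P M i j ∩ bface P M i) = 0 := fun {j} hij =>
    measure_mono_null (inter_subset_inter_right _ inter_subset_right) (M.overlap_boundary i j hij)
  have hd : Pairwise (Function.onFun (AEDisjoint (surf d)) s) := by
    intro o o' hoo
    cases o with
    | none =>
      cases o' with
      | none => exact absurd rfl hoo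
      | some j =>
        by_cases hij : i = j
        · simp [Function.onFun, s, hij, AEDisjoint]
        · rw [Function.onFun, hsome hij, AEDisjoint, inter_comm]; exact hbf hij
    | some j =>
      by_cases hij : i = j
      · simp [Function.onFun, s, hij, AEDisjoint]
      cases o' with
      | none => rw [Function.onFun, hsome hij]; exact hbf hij
      | some k =>
        by_cases hik : i = k
        · simp [Function.onFun, s, hik, AEDisjoint]
        rw [Function.onFun, hsome hij, hsome hik]
        exact measure_mono_null (inter_subset_inter_right _ (face_subset_right P M i k))
          (M.overlap i j k hij hik fun h => hoo (by rw [h]))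
  rw [bdry, hU] at hh
  have e1 : ∫ x, h x ∂(bdry (M.elem i)) = ∑ o, ∫ x in s o, h x ∂(surf d) := by
    rw [bdry, hU, integral_iUnion_ae (fun o => (hm o).nullMeasurableSet) hd hh, tsum_fintype]
  have e2 : (∑ e ∈ M.faces with e.1 = i, ∫ x in face P M i e.2, h x ∂(surf d))
      = ∑ j, if (i, j) ∈ M.faces then ∫ x in face P M i j, h x ∂(surf d) else 0 := by
    rw [← Finset.sum_filter]
    refine Finset.sum_nbij' (fun e => e.2) (fun j => (i, j)) ?_ ?_ ?_ ?_ ?_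
    · rintro ⟨a, b⟩ he
      simp only [Finset.mem_filter, Finset.mem_univ, true_and] at he ⊢
      rw [← he.2]; exact he.1
    · intro j hj
      simpa using hj
    · rintro ⟨a, b⟩ he
      simp only [Finset.mem_filter] at he
      rw [← he.2]
    · intro j _; rfl
    · intro e _; rfl
  have e3 : (∑ e ∈ M.faces with e.2 = i, ∫ x in face P M i e.1, h x ∂(surf d))
      = ∑ j, if (j, i) ∈ M.faces then ∫ x in face P M i j, h x ∂(surf d) else 0 := by
    rw [← Finset.sum_filter]
    refine Finset.sum_nbij' (fun e => e.1) (fun j => (j, i)) ?_ ?_ ?_ ?_ ?_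
    · rintro ⟨a, b⟩ he
      simp only [Finset.mem_filter, Finset.mem_univ, true_and] at he ⊢
      rw [← he.2]; exact he.1
    · intro j hj
      simpa using hj
    · rintro ⟨a, b⟩ he
      simp only [Finset.mem_filter] at he
      rw [← he.2]
    · intro j _; rfl
    · intro e _; rfl
  rw [e1, Fintype.sum_option, e2, e3, ← Finset.sum_add_distrib, add_comm]
  congr 1
  refine Finset.sum_congr rfl fun j _ => ?_
  by_cases hmem : (i, j) ∈ M.faces ∨ (j, i) ∈ M.faces
  · rw [hsome ((M.mem_faces i j).1 hmem).1]
    by_cases h1 : (i, j) ∈ M.faces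
    · rw [if_pos h1, if_neg (M.oriented i j h1), add_zero]
    · rw [if_neg h1, if_pos (hmem.resolve_left h1), zero_add]
  · have h0 : surf d (s (some j)) = 0 := by
      by_cases hij : i = j
      · simp [s, hij]
      · rw [hsome hij]
        by_contra h
        exact hmem ((M.mem_faces i j).2 ⟨hij, pos_iff_ne_zero.2 h⟩)
    rw [not_or] at hmem
    rw [if_neg hmem.1, if_neg hmem.2, Measure.restrict_eq_zero.2 h0, integral_zero_measure, add_zero]

/-- The one-sided normal traces of a field with a weak divergence in `Ω` cancel on the interior
faces. -/
theorem normalTrace_add_eq_zero (hd : 1 ≤ d) (hΩ : IsOpen P.Ω) {σ : Pt d → Pt d} {D : Pt d → ℝ}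
    (hD : HasWeakDiv P.Ω σ D) (hσ : ∀ i, IntegrableOn σ (M.elem i)) {q : ι → Pt d → ℝ}
    (hq : ∀ i, IsNormalTrace (M.elem i) σ (q i)) {i j : ι} (hij : i ≠ j) :
    ∀ᵐ x ∂((surf d).restrict (face P M i j)), q i x + q j x = 0 := by
  classical
  have hgreen := fun i => (hq i).green (isOpen_elem P M i) (hD.mono hΩ (M.subset i))
  have hsum : ∀ φ : Pt d → ℝ, IsTest φ → tsupport φ ⊆ P.Ω →
      ∑ i, ∫ x, q i x * φ x ∂(bdry (M.elem i)) = 0 := fun φ hφ hs => by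
    have h := hD.2.2 φ hφ hs
    rw [volume_restrict_eq_sum P M hd,
      integral_finsetSum_measure fun i _ => hφ.integrable_inner_gradient (hσ i),
      integral_finsetSum_measure fun i _ => hφ.integrable_mul (hgreen i).1] at h
    have : ∀ i, ∫ x, q i x * φ x ∂(bdry (M.elem i)) =
        (∫ x in M.elem i, ⟪σ x, gradient φ x⟫) + ∫ x in M.elem i, D x * φ x := fun i => by
      rw [← (hgreen i).2 φ hφ, integral_add (hφ.integrable_inner_gradient (hσ i))
        (hφ.integrable_mul (hgreen i).1)]
    simp only [this, Finset.sum_add_distrib]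
    linarith
  let S : Set (Pt d) := ⋃ i, frontier (M.elem i)
  let s : Pt d → ℝ := fun x => ∑ i, (frontier (M.elem i)).indicator (q i) x
  have hfm : ∀ i, MeasurableSet (frontier (M.elem i)) := fun i => isClosed_frontier.measurableSet
  have hS : ∀ i, frontier (M.elem i) ⊆ S := fun i =>
    subset_iUnion (fun i => frontier (M.elem i)) i
  have hres : ∀ i, ((surf d).restrict S).restrict (frontier (M.elem i)) = bdry (M.elem i) := fun i => by
    rw [Measure.restrict_restrict (hfm i), inter_eq_left.2 (hS i), bdry]
  have hsi : ∀ i, Integrable ((frontier (M.elem i)).indicator (q i)) ((surf d).restrict S) := fun i => by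
    rw [integrable_indicator_iff (hfm i), IntegrableOn, hres]
    exact (hq i).1
  have hs : Integrable s ((surf d).restrict S) := integrable_finsetSum _ fun i _ => hsi i
  have key : ∀ᵐ x ∂((surf d).restrict S), x ∈ P.Ω → s x = 0 := by
    refine hΩ.ae_eq_zero_of_integral_contDiff_smul_eq_zero hs.integrableOn.locallyIntegrableOn
      fun φ h1 h2 h3 => ?_
    have hφ : IsTest φ := ⟨h1, h2⟩
    rw [← hsum φ hφ h3]
    have e : ∀ x, φ x • s x = ∑ i, (frontier (M.elem i)).indicator (q i) x * φ x := fun x => by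
      rw [smul_eq_mul, mul_comm, Finset.sum_mul]
    simp only [e]
    rw [integral_finsetSum _ fun i _ => hφ.integrable_mul (hsi i)]
    refine Finset.sum_congr rfl fun i _ => ?_
    rw [← hres i, ← integral_indicator (hfm i)]
    congr 1 with x
    by_cases hx : x ∈ frontier (M.elem i) <;> simp [hx]
  have hsub : face P M i j ⊆ S := (face_subset P M i j).trans (hS i)
  have hno : ∀ᵐ x ∂((surf d).restrict (face P M i j)), ∀ k, i ≠ k → j ≠ k →
      x ∉ frontier (M.elem k) := by
    rw [ae_all_iff]
    intro k
    by_cases hik : i = k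
    · exact .of_forall fun x h => absurd hik h
    by_cases hjk : j = k
    · exact .of_forall fun x _ h => absurd hjk h
    exact (ae_restrict_notMem (measurableSet_face P M i j) (M.overlap i j k hij hik hjk)).mono
      fun x hx _ _ => hx
  filter_upwards [ae_restrict_of_ae_restrict_of_subset hsub key, hno,
    ae_restrict_notMem (measurableSet_face P M i j) (M.overlap_boundary i j hij),
    ae_restrict_mem (measurableSet_face P M i j)] with x h1 h2 h3 h4
  have hxΩ : x ∈ P.Ω := by
    by_contra h
    exact h3 (hΩ.frontier_eq ▸ ⟨closure_elem_subset P M i h4.1.1, h⟩)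
  have h5 := h1 hxΩ
  simp only [s] at h5
  rw [Finset.sum_eq_add i j hij (fun k _ hk => indicator_of_notMem (h2 k hk.1.symm hk.2.symm) _)
    (fun h => absurd (Finset.mem_univ _) h) (fun h => absurd (Finset.mem_univ _) h),
    indicator_of_mem h4.1, indicator_of_mem h4.2] at h5
  exact h5

end Geometry

/-! ### Fluxes of the exact solution -/

section Solution

variable {d : ℕ}

theorem contDiff_pval (p : MvPolynomial (Fin d) ℝ) : ContDiff ℝ ∞ (pval p) := by
  induction p using MvPolynomial.induction_on with
  | C a => 
    have : pval (MvPolynomial.C a : MvPolynomial (Fin d) ℝ) = fun _ => a := by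
      funext x; simp [pval]
    rw [this]
    exact contDiff_const
  | add p q hp hq => 
    have : pval (p + q) = fun x => pval p x + pval q x := by
      funext x; simp [pval]
    rw [this]
    exact hp.add hq
  | mul_X p k hp =>
    have : pval (p * MvPolynomial.X k) = fun x => pval p x * x k := by
      funext x; simp [pval]
    rw [this]
    exact hp.mul (contDiff_piLp_apply 2)

theorem integrable_mul_of_contDiff {K : Set (Pt d)} (hb : Bornology.IsBounded K)
    {μ : Measure (Pt d)} (hμ : ∀ᵐ x ∂μ, x ∈ closure K) {φ f : Pt d → ℝ} (hφ : ContDiff ℝ ∞ φ)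
    (hf : Integrable f μ) : Integrable (fun x => f x * φ x) μ := by
  obtain ⟨C, hC⟩ := hb.isCompact_closure.exists_bound_of_continuousOn hφ.continuous.continuousOn
  exact hf.mul_bdd hφ.continuous.aestronglyMeasurable (hμ.mono fun x hx => hC x hx)

theorem integrable_inner_gradient_of_contDiff {K : Set (Pt d)} (hb : Bornology.IsBounded K)
    {μ : Measure (Pt d)} (hμ : ∀ᵐ x ∂μ, x ∈ closure K) {φ : Pt d → ℝ} {σ : Pt d → Pt d}
    (hφ : ContDiff ℝ ∞ φ) (hσ : Integrable σ μ) :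
    Integrable (fun x => ⟪σ x, gradient φ x⟫) μ := by
  have hc := continuous_gradient hφ
  obtain ⟨C, hC⟩ := hb.isCompact_closure.exists_bound_of_continuousOn hc.continuousOn
  refine (hσ.norm.mul_const C).mono' (hσ.1.inner hc.aestronglyMeasurable) ?_
  filter_upwards [hμ] with x hx
  exact (norm_inner_le_norm _ _).trans (by gcongr; exact hC x hx)

theorem integrableOn_coefficient {K : Set (Pt d)} (hK : IsOpen K) (hb : Bornology.IsBounded K)
    {A : Pt d → (Pt d →L[ℝ] Pt d)} {C : NNReal} (hA : LipschitzOnWith C A K) {w : Pt d → Pt d}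
    (hw : IntegrableOn w K) : IntegrableOn (fun x => A x (w x)) K := by
  obtain ⟨B, C', hB, he⟩ := exists_lipschitz_extension hA
  obtain ⟨M, hM⟩ := hb.isCompact_closure.exists_bound_of_continuousOn hB.continuous.continuousOn
  have hmem : ∀ᵐ x ∂(volume.restrict K), x ∈ K := ae_restrict_mem hK.measurableSet
  have hBm : AEStronglyMeasurable (fun x => B x (w x)) (volume.restrict K) :=
    (ContinuousLinearMap.id ℝ (Pt d →L[ℝ] Pt d)).aestronglyMeasurable_comp₂
      hB.continuous.aestronglyMeasurable hw.1
  have hBi : Integrable (fun x => B x (w x)) (volume.restrict K) := by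
    refine (hw.norm.const_mul M).mono' hBm ?_
    filter_upwards [hmem] with x hx
    exact (B x).le_of_opNorm_le (hM x (subset_closure hx)) _
  exact hBi.congr (hmem.mono fun x hx => by simp only [he hx])

variable {ι : Type*} {P : Problem d} {M : Mesh P.Ω ι} {c : Pt d → ℝ}

theorem ae_mem_closure_elem (i : ι) : ∀ᵐ x ∂(volume.restrict (M.elem i)), x ∈ closure (M.elem i) :=
  (ae_restrict_mem (isOpen_elem P M i).measurableSet).mono fun _ hx => subset_closure hx

theorem ae_mem_closure_bdry (i : ι) : ∀ᵐ x ∂(bdry (M.elem i)), x ∈ closure (M.elem i) :=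
  (ae_restrict_mem isClosed_frontier.measurableSet).mono fun _ hx => hx.1

theorem ElementwiseRegular.isConormalTrace (hreg : ElementwiseRegular P M c) (i : ι) :
    IsConormalTrace (M.elem i) (M.normal i) P.A c (cn P M c i) := by
  rw [cn, conormalTrace, dif_pos (hreg.conormal i)]
  exact (hreg.conormal i).choose_spec

theorem ElementwiseRegular.isTrace (hreg : ElementwiseRegular P M c) (i : ι) :
    IsTrace (M.elem i) c (tr P M c i) := by
  rw [tr, AdvDiffDG.trace, dif_pos (hreg.trace i)]
  exact (hreg.trace i).choose_spec

theorem DataAssumptions.isNormalTrace_un (hdata : DataAssumptions P M) (i : ι) :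
    IsNormalTrace (M.elem i) P.u (un P M i) := by
  rw [un, normalTrace, dif_pos (hdata.u_normal i)]
  exact (hdata.u_normal i).choose_spec

theorem ElementwiseRegular.memLp_weakGrad (hreg : ElementwiseRegular P M c) (i : ι) :
    MemLp (weakGrad (M.elem i) c) 2 (volume.restrict (M.elem i)) :=
  (hreg.memH1 i).memLp_weakGrad (isOpen_elem P M i)

theorem isNormalTrace_cn (hdata : DataAssumptions P M) (hreg : ElementwiseRegular P M c) (i : ι) :
    IsNormalTrace (M.elem i) (fun x => P.A x (weakGrad (M.elem i) c x)) (cn P M c i) := by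
  obtain ⟨C, hC⟩ := hdata.A_lipschitz i
  exact (hreg.isConormalTrace i).isNormalTrace (isOpen_elem P M i) (M.bounded i)
    (M.finite_boundary i) (M.isOutwardNormal i) hC (hreg.memLp_weakGrad i)

theorem integrableOn_flux (hdata : DataAssumptions P M) (hreg : ElementwiseRegular P M c) (i : ι) :
    IntegrableOn (fun x => P.A x (weakGrad (M.elem i) c x)) (M.elem i) := by
  obtain ⟨C, hC⟩ := hdata.A_lipschitz i
  have : IsFiniteMeasure (volume.restrict (M.elem i)) :=
    ⟨by rw [Measure.restrict_apply_univ]; exact volume_elem_lt_top P M i⟩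
  exact integrableOn_coefficient (isOpen_elem P M i) (M.bounded i) hC
    ((hreg.memLp_weakGrad i).integrable one_le_two)

theorem DataAssumptions.isOpen (hdata : DataAssumptions P M) : IsOpen P.Ω := hdata.lipschitz.1

theorem DataAssumptions.memLp_u (hdata : DataAssumptions P M) (i : ι) :
    MemLp P.u 2 (volume.restrict (M.elem i)) :=
  hdata.u_Hdiv.1.mono_measure (Measure.restrict_mono_set _ (M.subset i))

theorem DataAssumptions.memLp_div_u (hdata : DataAssumptions P M) (i : ι) :
    MemLp (weakDiv P.Ω P.u) 2 (volume.restrict (M.elem i)) :=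
  (hdata.u_Hdiv.memLp_weakDiv hdata.isOpen).mono_measure (Measure.restrict_mono_set _ (M.subset i))

/-- The product rule and the normal trace for the advective flux `c u` on an element. -/
theorem advective_flux (hdata : DataAssumptions P M) (hreg : ElementwiseRegular P M c) (i : ι) :
    HasWeakDiv (M.elem i) (fun x => c x • P.u x)
        (fun x => ⟪P.u x, weakGrad (M.elem i) c x⟫ + c x * weakDiv P.Ω P.u x) ∧
      IsNormalTrace (M.elem i) (fun x => c x • P.u x) (fun x => un P M i x * tr P M c i x) :=
  (hdata.isNormalTrace_un i).smul_of_isTrace (isOpen_elem P M i) (M.bounded i) (hdata.memLp_u i)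
    (hdata.u_Hdiv.hasWeakDiv.mono hdata.isOpen (M.subset i)) (hdata.memLp_div_u i)
    (hreg.memH1 i).1 (hreg.memLp_weakGrad i) (hreg.isTrace i) (hreg.integrable i)

theorem integrableOn_smul_u (hdata : DataAssumptions P M) (hreg : ElementwiseRegular P M c)
    (i : ι) : IntegrableOn (fun x => c x • P.u x) (M.elem i) :=
  ((hreg.memH1 i).1.norm.integrable_mul (hdata.memLp_u i).norm).mono'
    ((hreg.memH1 i).1.1.smul (hdata.memLp_u i).1) (.of_forall fun _ => (norm_smul _ _).le)

theorem advTerm_ae_eq (hdata : DataAssumptions P M) (hreg : ElementwiseRegular P M c) (i : ι) :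
    advTerm P M c i =ᵐ[volume.restrict (M.elem i)] fun x =>
      ⟪P.u x, weakGrad (M.elem i) c x⟫ + c x * weakDiv P.Ω P.u x / 2 := by
  have h := (advective_flux hdata hreg i).1
  filter_upwards [h.weakDiv.ae_eq (isOpen_elem P M i) h] with x hx
  rw [advTerm, hx]
  ring

/-- There is no diffusive flux through the parts of the boundary without diffusion. -/
theorem cn_eq_zero_of_nAn_eq_zero (hdata : DataAssumptions P M) (hreg : ElementwiseRegular P M c)
    (i : ι) : ∀ᵐ x ∂(bdry (M.elem i)), nAn P M i x = 0 → cn P M c i x = 0 := by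
  obtain ⟨F, G, ε, δ, -, -, -, -, -, -, -, -, hq⟩ := hreg.isConormalTrace i
  obtain ⟨C, hC⟩ := hdata.A_lipschitz i
  filter_upwards [hq, ae_mem_closure_bdry (M := M) i] with x hx hcl h0
  obtain ⟨h1, h2⟩ := sided_symm_nonneg (isOpen_elem P M i) hC
    (ae_restrict_of_ae_restrict_of_subset (M.subset i) hdata.symm)
    (ae_restrict_of_ae_restrict_of_subset (M.subset i) hdata.nonneg) hcl
  rw [hx]
  exact inner_eq_zero_of_inner_self_eq_zero h1 h2 h0 _

theorem nAn_nonneg (hdata : DataAssumptions P M) (i : ι) {x : Pt d}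
    (hx : x ∈ closure (M.elem i)) : 0 ≤ nAn P M i x := by
  obtain ⟨C, hC⟩ := hdata.A_lipschitz i
  exact (sided_symm_nonneg (isOpen_elem P M i) hC
    (ae_restrict_of_ae_restrict_of_subset (M.subset i) hdata.symm)
    (ae_restrict_of_ae_restrict_of_subset (M.subset i) hdata.nonneg) hx).2 _

theorem aestronglyMeasurable_nAn (hdata : DataAssumptions P M) (i : ι) :
    AEStronglyMeasurable (nAn P M i) (bdry (M.elem i)) := by
  obtain ⟨C, hC⟩ := hdata.A_lipschitz i
  obtain ⟨B, C', hB, he⟩ := exists_lipschitz_extension hC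
  have hn := (M.isOutwardNormal i).1
  have hBm : AEStronglyMeasurable (fun x => B x (M.normal i x)) (bdry (M.elem i)) :=
    (ContinuousLinearMap.id ℝ (Pt d →L[ℝ] Pt d)).aestronglyMeasurable_comp₂
      hB.continuous.aestronglyMeasurable hn
  refine (hn.inner hBm).congr ?_
  filter_upwards [ae_mem_closure_bdry (M := M) i] with x hx
  rw [nAn, sided_eq_of_eqOn hB.continuous he hx]

variable [Fintype ι]

theorem totalFlux_eqOn (i : ι) : EqOn (totalFlux P M c)
    (fun x => -P.A x (weakGrad (M.elem i) c x) + c x • P.u x) (M.elem i) := fun x hx => by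
  rw [totalFlux, Finset.sum_eq_single i, indicator_of_mem hx]
  · exact fun j _ hj => indicator_of_notMem
      (fun h => disjoint_left.1 (M.disjoint j i hj) h hx) _
  · exact fun h => absurd (Finset.mem_univ _) h

theorem isNormalTrace_totalFlux (hdata : DataAssumptions P M) (hreg : ElementwiseRegular P M c)
    (i : ι) : IsNormalTrace (M.elem i) (totalFlux P M c)
      (fun x => -cn P M c i x + un P M i x * tr P M c i x) := by
  have hK := isOpen_elem P M i
  exact (((isNormalTrace_cn hdata hreg i).neg hK (integrableOn_flux hdata hreg i)).add hK
    (advective_flux hdata hreg i).2 (integrableOn_flux hdata hreg i).neg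
      (integrableOn_smul_u hdata hreg i)).congr hK (totalFlux_eqOn i).symm (.refl _ _)

theorem integrableOn_totalFlux (hdata : DataAssumptions P M) (hreg : ElementwiseRegular P M c)
    (i : ι) : IntegrableOn (totalFlux P M c) (M.elem i) :=
  ((integrableOn_flux hdata hreg i).neg.add (integrableOn_smul_u hdata hreg i)).congr
    ((ae_restrict_mem (isOpen_elem P M i).measurableSet).mono fun _ hx =>
      (totalFlux_eqOn i hx).symm)

/-- The weak divergence of the total flux on an element. -/
theorem weakDiv_totalFlux_ae_eq (hdata : DataAssumptions P M) (hreg : ElementwiseRegular P M c)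
    (hc : IsExactSolution P M c) (i : ι) :
    weakDiv P.Ω (totalFlux P M c) =ᵐ[volume.restrict (M.elem i)] fun x =>
      -weakDiv (M.elem i) (fun y => P.A y (weakGrad (M.elem i) c y)) x +
        (⟪P.u x, weakGrad (M.elem i) c x⟫ + c x * weakDiv P.Ω P.u x) := by
  have hK := isOpen_elem P M i
  have h1 : HasWeakDiv (M.elem i) (totalFlux P M c) (weakDiv P.Ω (totalFlux P M c)) :=
    hc.flux.hasWeakDiv.mono hdata.isOpen (M.subset i)
  obtain ⟨_, δ, hδ, _, _⟩ := isNormalTrace_cn hdata hreg i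
  obtain ⟨hd1, hN1⟩ := advective_flux hdata hreg i
  have hd2 := hδ.weakDiv
  have hN2 := isNormalTrace_cn hdata hreg i
  have hi1 := (hN1.green hK hd1).1
  have hi2 := (hN2.green hK hd2).1
  refine h1.ae_eq hK (HasWeakDiv.congr hK ?_ (totalFlux_eqOn i).symm)
  have hf := integrableOn_flux hdata hreg i
  have hu := integrableOn_smul_u hdata hreg i
  refine ⟨(hf.neg.add hu).locallyIntegrableOn, (hi2.neg.add hi1).locallyIntegrableOn,
    fun φ hφ hs => ?_⟩
  have e1 := hd1.2.2 φ hφ hs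
  have e2 := hd2.2.2 φ hφ hs
  have s1 := integral_add (hφ.integrable_inner_gradient hf).neg (hφ.integrable_inner_gradient hu)
  have s2 := integral_add (hφ.integrable_mul hi2).neg (hφ.integrable_mul hi1)
  simp only [Pi.neg_apply, integral_neg] at s1 s2
  simp only [inner_add_left, inner_neg_left, add_mul _ (_ + _), neg_mul]
  rw [s1, s2, e1, e2]
  ring

/-- The exact solution satisfies the equation of the stabilized residual. -/
theorem residual_ae_eq (hdata : DataAssumptions P M) (hreg : ElementwiseRegular P M c)
    (hc : IsExactSolution P M c) (i : ι) :
    ∀ᵐ x ∂(volume.restrict (M.elem i)),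
      -weakDiv (M.elem i) (fun y => P.A y (weakGrad (M.elem i) c y)) x
        + advTerm P M c i x + γ0 P x * c x = P.g x := by
  filter_upwards [advTerm_ae_eq hdata hreg i, weakDiv_totalFlux_ae_eq hdata hreg hc i,
    ae_restrict_of_ae_restrict_of_subset (M.subset i) hc.pde] with x h1 h2 h3
  rw [h1, ← h3, h2, γ0]
  ring

theorem Sform_eq_Tform (hdata : DataAssumptions P M) (hreg : ElementwiseRegular P M c)
    (hc : IsExactSolution P M c) (α : ℝ) (v : ι → MvPolynomial (Fin d) ℝ) :
    Sform P M α c v = Tform P M α v := by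
  refine Finset.sum_congr rfl fun i _ => integral_congr_ae ?_
  filter_upwards [residual_ae_eq hdata hreg hc i] with x hx
  rw [hx]

/-- Integration by parts on one element. -/
theorem elementwise_identity (hdata : DataAssumptions P M) (hreg : ElementwiseRegular P M c)
    (hc : IsExactSolution P M c) (i : ι) {φ : Pt d → ℝ} (hφ : ContDiff ℝ ∞ φ) :
    (∫ x in M.elem i, ⟪P.A x (weakGrad (M.elem i) c x), gradient φ x⟫)
      + (∫ x in M.elem i, advTerm P M c i x * φ x) + (∫ x in M.elem i, γ0 P x * c x * φ x)
      = ∫ x, cn P M c i x * φ x ∂(bdry (M.elem i)) + ∫ x in M.elem i, P.g x * φ x := by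
  have hK := isOpen_elem P M i
  have hb := M.bounded i
  have : IsFiniteMeasure (volume.restrict (M.elem i)) :=
    ⟨by rw [Measure.restrict_apply_univ]; exact volume_elem_lt_top P M i⟩
  have hcl := ae_mem_closure_elem (M := M) i
  have hN := isNormalTrace_cn hdata hreg i
  obtain ⟨_, δ, hδ, _, _⟩ := isNormalTrace_cn hdata hreg i
  have hd := hδ.weakDiv
  have hδi := (hN.green hK hd).1
  have hcδ : Integrable (fun x => c x * weakDiv P.Ω P.u x) (volume.restrict (M.elem i)) :=
    (hreg.memH1 i).1.integrable_mul (hdata.memLp_div_u i)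
  have hadv : Integrable (advTerm P M c i) (volume.restrict (M.elem i)) := by
    refine Integrable.congr ?_ (advTerm_ae_eq hdata hreg i).symm
    exact (integrable_inner_of_memLp (hdata.memLp_u i) (hreg.memLp_weakGrad i)).add (hcδ.div_const 2)
  have hg : Integrable P.g (volume.restrict (M.elem i)) :=
    (hdata.g_mem.mono_measure (Measure.restrict_mono_set _ (M.subset i))).integrable one_le_two
  have hγ : Integrable (fun x => γ0 P x * c x) (volume.restrict (M.elem i)) := by
    refine ((hg.add hδi).sub hadv).congr ?_
    filter_upwards [residual_ae_eq hdata hreg hc i] with x hx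
    simp only [Pi.add_apply, Pi.sub_apply]
    linarith
  have m : ∀ {f : Pt d → ℝ}, Integrable f (volume.restrict (M.elem i)) →
      Integrable (fun x => f x * φ x) (volume.restrict (M.elem i)) := fun hf =>
    integrable_mul_of_contDiff hb hcl hφ hf
  have mA := integrable_inner_gradient_of_contDiff hb hcl hφ (integrableOn_flux hdata hreg i)
  have s1 := integral_add (mA.add (m hadv)) (m hγ)
  have s2 := integral_add (mA.add (m hδi)) (m hg)
  simp only [Pi.add_apply] at s1 s2
  rw [← hN.green_of_contDiff hK hb hd hφ, ← integral_add mA (m hadv), ← s1, ← s2]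
  refine integral_congr_ae ?_
  filter_upwards [residual_ae_eq hdata hreg hc i] with x hx
  rw [← hx]
  ring

theorem un_add_un (hd : 1 ≤ d) (hdata : DataAssumptions P M) {i j : ι} (hij : i ≠ j) :
    ∀ᵐ x ∂((surf d).restrict (face P M i j)), un P M i x + un P M j x = 0 := by
  refine normalTrace_add_eq_zero P M hd hdata.isOpen hdata.u_Hdiv.hasWeakDiv (fun i => ?_)
    hdata.isNormalTrace_un hij
  have : IsFiniteMeasure (volume.restrict (M.elem i)) :=
    ⟨by rw [Measure.restrict_apply_univ]; exact volume_elem_lt_top P M i⟩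
  exact (hdata.memLp_u i).integrable one_le_two

theorem totalFlux_add (hd : 1 ≤ d) (hdata : DataAssumptions P M)
    (hreg : ElementwiseRegular P M c) (hc : IsExactSolution P M c) {i j : ι} (hij : i ≠ j) :
    ∀ᵐ x ∂((surf d).restrict (face P M i j)),
      (-cn P M c i x + un P M i x * tr P M c i x)
        + (-cn P M c j x + un P M j x * tr P M c j x) = 0 :=
  normalTrace_add_eq_zero P M hd hdata.isOpen hc.flux.hasWeakDiv
    (integrableOn_totalFlux hdata hreg) (isNormalTrace_totalFlux hdata hreg) hij

end Solution

/-! ### Cancellation on the faces -/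

section Faces

variable {d : ℕ}

theorem setIntegral_inter_eq {μ : Measure (Pt d)} {s t : Set (Pt d)} {f : Pt d → ℝ}
    (ht : NullMeasurableSet t (μ.restrict s)) :
    ∫ x in s ∩ t, f x ∂μ = ∫ x in s, t.indicator f x ∂μ := by
  rw [integral_indicator₀ ht, Measure.restrict_restrict₀ ht, inter_comm]

variable {ι : Type*} {P : Problem d} {M : Mesh P.Ω ι} {c : Pt d → ℝ}

theorem nullMeasurableSet_inflow (hdata : DataAssumptions P M) (i : ι) {S : Set (Pt d)}
    (hS : S ⊆ frontier (M.elem i)) :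
    NullMeasurableSet {x | un P M i x < 0} ((surf d).restrict S) :=
  nullMeasurableSet_lt ((hdata.isNormalTrace_un i).1.1.mono_set hS).aemeasurable aemeasurable_const

theorem integrable_on_bdry (i : ι) {S : Set (Pt d)} (hS : S ⊆ frontier (M.elem i))
    {q : Pt d → ℝ} (hq : Integrable q (bdry (M.elem i))) (p : MvPolynomial (Fin d) ℝ) :
    Integrable (fun x => q x * pval p x) ((surf d).restrict S) :=
  (integrable_mul_of_contDiff (M.bounded i) (ae_mem_closure_bdry i) (contDiff_pval p) hq).mono_measure
    (Measure.restrict_mono_set _ hS)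

variable (P M c) in
/-- The upwind flux `u·n [c]` through `∂K_i ∩ ∂K_j` into the element `K_i`; it vanishes on the
outflow part. -/
def upwind (i j : ι) : Pt d → ℝ :=
  {x | un P M i x < 0}.indicator fun x => un P M i x * (tr P M c i x - tr P M c j x)

variable (P M c) in
/-- The diffusive fluxes from both sides of a face agree with the upwind fluxes. -/
def FluxEqUpwind (i j : ι) : Prop := ∀ᵐ x ∂((surf d).restrict (face P M i j)),
  cn P M c i x = upwind P M c i j x ∧ cn P M c j x = upwind P M c j i x

theorem FluxEqUpwind.symm {i j : ι} (h : FluxEqUpwind P M c i j) : FluxEqUpwind P M c j i := by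
  rw [FluxEqUpwind, face_comm]
  exact h.mono fun x hx => ⟨hx.2, hx.1⟩

theorem integral_inflow_eq (hdata : DataAssumptions P M) (i j : ι) (p : MvPolynomial (Fin d) ℝ) :
    ∫ x in face P M i j ∩ {x | un P M i x < 0},
        pval p x * (un P M i x * (tr P M c i x - tr P M c j x)) ∂(surf d)
      = ∫ x in face P M i j, upwind P M c i j x * pval p x ∂(surf d) := by
  rw [setIntegral_inter_eq (nullMeasurableSet_inflow hdata i (face_subset P M i j))]
  congr 1 with x
  by_cases hx : un P M i x < 0 <;> simp [upwind, hx, mul_comm]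

theorem AdvSide.cn_eq_zero (hdata : DataAssumptions P M) (hreg : ElementwiseRegular P M c)
    {i j : ι} (h : AdvSide P M i j) :
    ∀ᵐ x ∂((surf d).restrict (face P M i j)), cn P M c i x = 0 := by
  filter_upwards [h, ae_restrict_of_ae_restrict_of_subset (face_subset P M i j)
    (cn_eq_zero_of_nAn_eq_zero hdata hreg i)] with x h1 h2 using h2 h1

theorem dirFace_eq (hdata : DataAssumptions P M) (i : ι) :
    dirFace P M i = bface P M i ∩ P.ΓdfD := by
  ext x
  exact ⟨fun h => ⟨⟨h.1, hdata.ΓdfD_subset h.2⟩, h.2⟩, fun h => ⟨h.1.1, h.2⟩⟩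

variable [Fintype ι]

/-- Continuity of the total flux, as a formula for the jump of the diffusive flux. -/
theorem cn_add_cn (hd : 1 ≤ d) (hdata : DataAssumptions P M) (hreg : ElementwiseRegular P M c)
    (hc : IsExactSolution P M c) {i j : ι} (hij : i ≠ j) :
    ∀ᵐ x ∂((surf d).restrict (face P M i j)), un P M j x = -un P M i x ∧
      cn P M c i x + cn P M c j x = un P M i x * (tr P M c i x - tr P M c j x) := by
  filter_upwards [un_add_un hd hdata hij, totalFlux_add hd hdata hreg hc hij] with x h1 h2
  have h3 : un P M j x = -un P M i x := by linarith
  refine ⟨h3, ?_⟩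
  rw [h3] at h2
  linarith

/-- If one side has no diffusion and the advective flux is continuous, both diffusive fluxes and
both upwind fluxes vanish. -/
theorem fluxEqUpwind_of_jump_eq_zero (hd : 1 ≤ d) (hdata : DataAssumptions P M)
    (hreg : ElementwiseRegular P M c) (hc : IsExactSolution P M c) {i j : ι} (hij : i ≠ j)
    (hadv : AdvSide P M i j ∨ AdvSide P M j i)
    (h : ∀ᵐ x ∂((surf d).restrict (face P M i j)),
      un P M i x * (tr P M c i x - tr P M c j x) = 0) : FluxEqUpwind P M c i j := by
  have h0 : ∀ᵐ x ∂((surf d).restrict (face P M i j)), cn P M c i x = 0 ∨ cn P M c j x = 0 := by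
    rcases hadv with ha | ha
    · exact (ha.cn_eq_zero hdata hreg).mono fun x hx => .inl hx
    · have := ha.cn_eq_zero hdata hreg
      rw [face_comm] at this
      exact this.mono fun x hx => .inr hx
  filter_upwards [cn_add_cn hd hdata hreg hc hij, h0, h] with x ⟨h1, h2⟩ h3 h4
  have h5 : un P M j x * (tr P M c j x - tr P M c i x) = 0 := by rw [h1]; linarith
  have e1 : upwind P M c i j x = 0 := by
    classical
    rw [upwind, indicator_apply, h4, ite_self]
  have e2 : upwind P M c j i x = 0 := by
    classical
    rw [upwind, indicator_apply, h5, ite_self]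
  rw [h4] at h2
  rw [e1, e2]
  rcases h3 with h3 | h3 <;> constructor <;> linarith

/-- On an inflow advection-diffusion face the diffusive flux leaves the element with diffusion
through the jump of the advective flux. -/
theorem IsAdDfIn.fluxEqUpwind (hd : 1 ≤ d) (hdata : DataAssumptions P M)
    (hreg : ElementwiseRegular P M c) (hc : IsExactSolution P M c) {i j : ι} (hij : i ≠ j)
    (h : IsAdDfIn P M i j) : FluxEqUpwind P M c i j := by
  have hj := h.2.1.cn_eq_zero hdata hreg
  rw [face_comm] at hj
  filter_upwards [cn_add_cn hd hdata hreg hc hij, hj, h.2.2] with x ⟨h1, h2⟩ h3 h4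
  have h5 : ¬ un P M j x < 0 := by rw [h1]; linarith
  rw [upwind, upwind, indicator_of_mem (by exact h4), indicator_of_notMem (by exact h5)]
  exact ⟨by linarith, h3⟩

open Classical in
/-- The contribution of an interior face to the scheme vanishes. -/
theorem face_identity (hd : 1 ≤ d) (hdata : DataAssumptions P M) (hfaces : FacesClassified P M)
    (hreg : ElementwiseRegular P M c) (hc : IsExactSolution P M c)
    (hdfdf : ∀ e ∈ M.faces, IsDfDf P M e.1 e.2 →
      ∀ᵐ x ∂((surf d).restrict (face P M e.1 e.2)), tr P M c e.1 x - tr P M c e.2 x = 0)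
    (haddf : ∀ e ∈ M.faces, (IsAdDfOut P M e.1 e.2 ∨ IsAdDfOut P M e.2 e.1) →
      ∀ᵐ x ∂((surf d).restrict (face P M e.1 e.2)),
        un P M e.1 x * (tr P M c e.1 x - tr P M c e.2 x) = 0)
    (hadad : ∀ e ∈ M.faces, IsAdAd P M e.1 e.2 →
      ∀ᵐ x ∂((surf d).restrict (face P M e.1 e.2)),
        un P M e.1 x * (tr P M c e.1 x - tr P M c e.2 x) = 0)
    (v : ι → MvPolynomial (Fin d) ℝ) {e : ι × ι} (he : e ∈ M.faces) :
    (∫ x in face P M e.1 e.2, cn P M c e.1 x * pval (v e.1) x ∂(surf d))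
      + (∫ x in face P M e.2 e.1, cn P M c e.2 x * pval (v e.2) x ∂(surf d))
      = (if IsDfDf P M e.1 e.2 then ∫ x in face P M e.1 e.2,
          (cn P M c e.1 x - cn P M c e.2 x) / 2 * (pval (v e.1) x - pval (v e.2) x) ∂(surf d) else 0)
        + (∫ x in face P M e.1 e.2 ∩ {x | un P M e.1 x < 0},
            pval (v e.1) x * (un P M e.1 x * (tr P M c e.1 x - tr P M c e.2 x)) ∂(surf d))
        + (∫ x in face P M e.2 e.1 ∩ {x | un P M e.2 x < 0},
            pval (v e.2) x * (un P M e.2 x * (tr P M c e.2 x - tr P M c e.1 x)) ∂(surf d)) := by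
  obtain ⟨i, j⟩ := e
  have hij : i ≠ j := ((M.mem_faces i j).1 (.inl he)).1
  simp only
  rw [integral_inflow_eq hdata, integral_inflow_eq hdata, face_comm P M j i]
  by_cases hdd : IsDfDf P M i j
  · have hjump := hdfdf _ he hdd
    have hi : ∀ p, Integrable (fun x => cn P M c i x * pval p x)
        ((surf d).restrict (face P M i j)) :=
      integrable_on_bdry i (face_subset P M i j) (isNormalTrace_cn hdata hreg i).1
    have hj : ∀ p, Integrable (fun x => cn P M c j x * pval p x)
        ((surf d).restrict (face P M i j)) :=
      integrable_on_bdry j (face_subset_right P M i j) (isNormalTrace_cn hdata hreg j).1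
    have e1 : ∫ x in face P M i j, upwind P M c i j x * pval (v i) x ∂(surf d) = 0 := by
      refine integral_eq_zero_of_ae (hjump.mono fun x hx => ?_)
      classical
      simp only at hx
      simp [upwind, indicator_apply, hx]
    have e2 : ∫ x in face P M i j, upwind P M c j i x * pval (v j) x ∂(surf d) = 0 := by
      refine integral_eq_zero_of_ae (hjump.mono fun x hx => ?_)
      classical
      simp only at hx
      have hx' : tr P M c j x - tr P M c i x = 0 := by linarith
      simp [upwind, indicator_apply, hx']
    rw [if_pos hdd, e1, e2, add_zero, add_zero, ← integral_add (hi _) (hj _)]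
    refine integral_congr_ae ?_
    filter_upwards [hjump, cn_add_cn hd hdata hreg hc hij] with x h1 ⟨_, h2⟩
    rw [h1, mul_zero] at h2
    have h3 : cn P M c j x = -cn P M c i x := by linarith
    rw [h3]
    ring
  · have hU : FluxEqUpwind P M c i j := by
      have hcl : IsDfDf P M i j ∨ (IsAdDfIn P M i j ∨ IsAdDfIn P M j i) ∨
        (IsAdDfOut P M i j ∨ IsAdDfOut P M j i) ∨ IsAdAd P M i j := hfaces (i, j) he
      rcases hcl with h | (h | h) | h | h
      · exact absurd h hdd
      · exact h.fluxEqUpwind hd hdata hreg hc hij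
      · exact (h.fluxEqUpwind hd hdata hreg hc hij.symm).symm
      · exact fluxEqUpwind_of_jump_eq_zero hd hdata hreg hc hij
          (h.elim (fun h => .inr h.2.1) fun h => .inl h.2.1) (haddf (i, j) he h)
      · exact fluxEqUpwind_of_jump_eq_zero hd hdata hreg hc hij (.inl h.1) (hadad (i, j) he h)
    rw [if_neg hdd, zero_add]
    refine congrArg₂ (· + ·) ?_ ?_
    · exact integral_congr_ae (hU.mono fun x hx => by simp only [hx.1])
    · exact integral_congr_ae (hU.mono fun x hx => by simp only [hx.2])

/-- The contribution of `∂K_i ∩ ∂Ω` to the scheme vanishes. -/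
theorem bface_identity (hdata : DataAssumptions P M) (hreg : ElementwiseRegular P M c)
    (hc : IsExactSolution P M c) (i : ι) (p : MvPolynomial (Fin d) ℝ) :
    (∫ x in bface P M i, cn P M c i x * pval p x ∂(surf d))
      - (∫ x in dirFace P M i, cn P M c i x * pval p x ∂(surf d))
      - (∫ x in bface P M i ∩ {x | un P M i x < 0},
          pval p x * (un P M i x * tr P M c i x) ∂(surf d))
      + (∫ x in bface P M i ∩ {x | (nAn P M i x = 0 ∨ x ∈ P.ΓdfD) ∧ un P M i x < 0},
          pval p x * (un P M i x * P.κ x) ∂(surf d))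
      + (∫ x in bface P M i ∩ {x | x ∈ P.ΓdfN ∧ un P M i x < 0}, pval p x * P.χm x ∂(surf d))
      + (∫ x in bface P M i ∩ {x | x ∈ P.ΓdfN ∧ 0 ≤ un P M i x}, pval p x * P.χp x ∂(surf d))
      = 0 := by
  classical
  have hb := bface_subset P M i
  set μ := (surf d).restrict (bface P M i) with hμ
  have hW : NullMeasurableSet {x | un P M i x < 0} μ := nullMeasurableSet_inflow hdata i hb
  have hZ : NullMeasurableSet {x | nAn P M i x = 0} μ :=
    nullMeasurableSet_eq_fun ((aestronglyMeasurable_nAn hdata i).mono_set hb).aemeasurable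
      aemeasurable_const
  have hD : NullMeasurableSet P.ΓdfD μ := hdata.ΓdfD_meas.nullMeasurableSet
  have hN : NullMeasurableSet P.ΓdfN μ := hdata.ΓdfN_meas.nullMeasurableSet
  have h4 : NullMeasurableSet {x | (nAn P M i x = 0 ∨ x ∈ P.ΓdfD) ∧ un P M i x < 0} μ :=
    (hZ.union hD).inter hW
  have h5 : NullMeasurableSet {x | x ∈ P.ΓdfN ∧ un P M i x < 0} μ := hN.inter hW
  have h6 : NullMeasurableSet {x | x ∈ P.ΓdfN ∧ 0 ≤ un P M i x} μ := by
    have : {x | x ∈ P.ΓdfN ∧ 0 ≤ un P M i x} = P.ΓdfN ∩ {x | un P M i x < 0}ᶜ := by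
      ext x; simp
    rw [this]
    exact hN.inter hW.compl
  have hX : Integrable (fun x => cn P M c i x * pval p x) μ :=
    integrable_on_bdry i hb (isNormalTrace_cn hdata hreg i).1 p
  have hY : Integrable (fun x => un P M i x * tr P M c i x * pval p x) μ :=
    integrable_on_bdry i hb (hreg.integrable i) p
  have hf3 : Integrable ({x | un P M i x < 0}.indicator
      fun x => pval p x * (un P M i x * tr P M c i x)) μ :=
    (hY.congr (.of_forall fun x => mul_comm _ _)).indicator₀ hW
  -- the data on the boundary are given by the traces of the solution
  have hf4 : Integrable ({x | (nAn P M i x = 0 ∨ x ∈ P.ΓdfD) ∧ un P M i x < 0}.indicator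
      fun x => pval p x * (un P M i x * P.κ x)) μ := by
    refine (hY.indicator₀ h4).congr ?_
    filter_upwards [hc.dirichlet i] with x hx
    by_cases h : (nAn P M i x = 0 ∨ x ∈ P.ΓdfD) ∧ un P M i x < 0
    · rw [indicator_of_mem (by exact h), indicator_of_mem (by exact h),
        hx (h.1.elim (fun h' => .inr ⟨h', h.2⟩) .inl)]
      ring
    · rw [indicator_of_notMem (by exact h), indicator_of_notMem (by exact h)]
  have hf5 : Integrable ({x | x ∈ P.ΓdfN ∧ un P M i x < 0}.indicator
      fun x => pval p x * P.χm x) μ := by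
    refine ((hY.sub hX).indicator₀ h5).congr ?_
    filter_upwards [hc.neumann_inflow i] with x hx
    by_cases h : x ∈ P.ΓdfN ∧ un P M i x < 0
    · rw [indicator_of_mem (by exact h), indicator_of_mem (by exact h), ← hx h, Pi.sub_apply]
      ring
    · rw [indicator_of_notMem (by exact h), indicator_of_notMem (by exact h)]
  have hf6 : Integrable ({x | x ∈ P.ΓdfN ∧ 0 ≤ un P M i x}.indicator
      fun x => pval p x * P.χp x) μ := by
    refine (hX.neg.indicator₀ h6).congr ?_
    filter_upwards [hc.neumann_outflow i] with x hx
    by_cases h : x ∈ P.ΓdfN ∧ 0 ≤ un P M i x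
    · rw [indicator_of_mem (by exact h), indicator_of_mem (by exact h), ← hx h, Pi.neg_apply]
      ring
    · rw [indicator_of_notMem (by exact h), indicator_of_notMem (by exact h)]
  have hf2 := hX.indicator₀ hD
  rw [dirFace_eq hdata, setIntegral_inter_eq hD, setIntegral_inter_eq hW, setIntegral_inter_eq h4,
    setIntegral_inter_eq h5, setIntegral_inter_eq h6, ← hμ, ← integral_sub' hX hf2,
    ← integral_sub' (hX.sub hf2) hf3, ← integral_add' ((hX.sub hf2).sub hf3) hf4,
    ← integral_add' (((hX.sub hf2).sub hf3).add hf4) hf5,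
    ← integral_add' ((((hX.sub hf2).sub hf3).add hf4).add hf5) hf6]
  refine integral_eq_zero_of_ae ?_
  filter_upwards [hc.dirichlet i, hc.neumann_inflow i, hc.neumann_outflow i, hdata.Γdf_eq i,
    ae_restrict_of_ae_restrict_of_subset hb (cn_eq_zero_of_nAn_eq_zero hdata hreg i),
    ae_restrict_of_ae_restrict_of_subset hb (ae_mem_closure_bdry (M := M) i)]
    with x g1 g2 g3 g4 g5 g6
  have g7 := nAn_nonneg hdata i g6
  have g8 : x ∈ P.ΓdfD → x ∉ P.ΓdfN := fun h => disjoint_left.1 hdata.Γdf_disjoint h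
  simp only [Pi.add_apply, Pi.sub_apply, Pi.zero_apply, indicator_apply, mem_ofPred_eq]
  by_cases hD' : x ∈ P.ΓdfD
  · have hN' := g8 hD'
    rw [← g1 (.inl hD')]
    by_cases hW' : un P M i x < 0 <;> simp [hD', hN', hW']
  by_cases hN' : x ∈ P.ΓdfN
  · have hZ' : nAn P M i x ≠ 0 := (g4.2 (.inr hN')).ne'
    by_cases hW' : un P M i x < 0
    · rw [← g2 ⟨hN', hW'⟩]
      simp only [hD', hN', hW', hZ', not_le.2 hW', if_true, if_false, or_self, and_true,
        and_false]
      ring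
    · rw [← g3 ⟨hN', not_lt.1 hW'⟩]
      simp only [hD', hN', hW', hZ', not_lt.1 hW', if_true, if_false, or_self, and_true,
        and_false]
      ring
  · have hZ' : nAn P M i x = 0 := by
      by_contra h
      exact (g4.1 (lt_of_le_of_ne g7 (Ne.symm h))).elim hD' hN'
    rw [g5 hZ']
    by_cases hW' : un P M i x < 0
    · rw [← g1 (.inr ⟨hZ', hW'⟩)]
      simp [hD', hN', hW', hZ']
    · simp [hD', hN', hW']

theorem sum_dirFaces_eq (f : ι → Pt d → ℝ) :
    ∑ i ∈ dirFaces P M, ∫ x in dirFace P M i, f i x ∂(surf d) =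
      ∑ i, ∫ x in dirFace P M i, f i x ∂(surf d) := by
  refine Finset.sum_subset (Finset.subset_univ _) fun i _ hi => ?_
  have h0 : surf d (dirFace P M i) = 0 := by
    by_contra h
    exact hi (by simpa [dirFaces] using pos_iff_ne_zero.2 h)
  rw [Measure.restrict_eq_zero.2 h0, integral_zero_measure]

open Classical in
theorem sum_filter_fst (s : Finset (ι × ι)) (F : ι → ι → ℝ) :
    ∑ i, ∑ e ∈ s with e.1 = i, F i e.2 = ∑ e ∈ s, F e.1 e.2 := by
  rw [← Finset.sum_fiberwise s (fun e => e.1)]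
  refine Finset.sum_congr rfl fun i _ => Finset.sum_congr rfl fun e he => ?_
  rw [(Finset.mem_filter.1 he).2]

open Classical in
theorem sum_filter_snd (s : Finset (ι × ι)) (F : ι → ι → ℝ) :
    ∑ i, ∑ e ∈ s with e.2 = i, F i e.1 = ∑ e ∈ s, F e.2 e.1 := by
  rw [← Finset.sum_fiberwise s (fun e => e.2)]
  refine Finset.sum_congr rfl fun i _ => Finset.sum_congr rfl fun e he => ?_
  rw [(Finset.mem_filter.1 he).2]

end Faces

end AdvDiffDG

end

open AdvDiffDG
theorem theorem3p1 {d : ℕ} (hd : d = 2 ∨ d = 3) {ι : Type*} [Fintype ι]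
    (P : Problem d) (M : Mesh P.Ω ι) (hdata : DataAssumptions P M)
    (hfaces : FacesClassified P M)
    (c : Pt d → ℝ) (hreg : ElementwiseRegular P M c) (hc : IsExactSolution P M c)
    (hdfdf : ∀ e ∈ M.faces, IsDfDf P M e.1 e.2 →
      ∀ᵐ x ∂((surf d).restrict (face P M e.1 e.2)), tr P M c e.1 x - tr P M c e.2 x = 0)
    (haddf : ∀ e ∈ M.faces, (IsAdDfOut P M e.1 e.2 ∨ IsAdDfOut P M e.2 e.1) →
      ∀ᵐ x ∂((surf d).restrict (face P M e.1 e.2)),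
        un P M e.1 x * (tr P M c e.1 x - tr P M c e.2 x) = 0)
    (hadad : ∀ e ∈ M.faces, IsAdAd P M e.1 e.2 →
      ∀ᵐ x ∂((surf d).restrict (face P M e.1 e.2)),
        un P M e.1 x * (tr P M c e.1 x - tr P M c e.2 x) = 0)
    (ℓ : ℕ) (hℓ : 1 ≤ ℓ) (α : ℝ) (hα : 0 < α) :
    ∀ v ∈ Uh d ι ℓ, Lform P M α c v = Rform P M α v := by
  classical
  intro v _
  have hd1 : 1 ≤ d := by omega
  have hΩ := hdata.isOpen
  have hdd : ∀ e ∈ dfdfFaces P M, e ∈ M.faces ∧ IsDfDf P M e.1 e.2 := fun e he => by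
    simpa [dfdfFaces] using he
  -- the terms with `[c]` on the faces with diffusion on both sides vanish
  have hsymm : ∑ e ∈ dfdfFaces P M, ∫ x in face P M e.1 e.2,
      (polyFlux P M e.1 (v e.1) (M.normal e.1) x + polyFlux P M e.2 (v e.2) (M.normal e.1) x) / 2
        * (tr P M c e.1 x - tr P M c e.2 x) ∂(surf d) = 0 :=
    Finset.sum_eq_zero fun e he => integral_eq_zero_of_ae <| by
      filter_upwards [hdfdf e (hdd e he).1 (hdd e he).2] with x hx
      simp [hx]
  have hpen : ∑ e ∈ dfdFaces P M, (faceScale (face P M e.1 e.2))⁻¹ * AFace P M e *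
      ∫ x in face P M e.1 e.2,
        (tr P M c e.1 x - tr P M c e.2 x) * (pval (v e.1) x - pval (v e.2) x) ∂(surf d) = 0 :=
    Finset.sum_eq_zero fun e he => by
      have he' := hdd e (Finset.mem_filter.1 he).1
      rw [integral_eq_zero_of_ae, mul_zero]
      filter_upwards [hdfdf e he'.1 he'.2] with x hx
      simp [hx]
  -- on the Dirichlet faces with diffusion the trace of `c` is the datum
  have hκ : ∀ i, ∀ᵐ x ∂((surf d).restrict (dirFace P M i)), tr P M c i x = P.κ x := fun i => by
    rw [dirFace_eq hdata]
    filter_upwards [ae_restrict_of_ae_restrict_of_subset inter_subset_left (hc.dirichlet i),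
      ae_restrict_mem ((measurableSet_bface P M i).inter hdata.ΓdfD_meas)] with x h1 h2
    exact h1 (.inl h2.2)
  have hdirF : ∀ i, ∫ x in dirFace P M i,
      polyFlux P M i (v i) (M.normal i) x * tr P M c i x ∂(surf d) = ∫ x in dirFace P M i,
        polyFlux P M i (v i) (M.normal i) x * P.κ x ∂(surf d) := fun i =>
    integral_congr_ae ((hκ i).mono fun x hx => by simp only [hx])
  have hdirP : ∀ i, ∫ x in dirFace P M i, tr P M c i x * pval (v i) x ∂(surf d) =
      ∫ x in dirFace P M i, P.κ x * pval (v i) x ∂(surf d) := fun i =>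
    integral_congr_ae ((hκ i).mono fun x hx => by simp only [hx])
  have hvol := Finset.sum_congr (rfl : (Finset.univ : Finset ι) = Finset.univ) fun i _ =>
    elementwise_identity hdata hreg hc i (contDiff_pval (v i))
  simp only [Finset.sum_add_distrib, integral_bdry_eq P M hΩ _ (integrable_mul_of_contDiff
    (M.bounded _) (ae_mem_closure_bdry _) (contDiff_pval _) (isNormalTrace_cn hdata hreg _).1)]
    at hvol
  rw [sum_filter_fst M.faces fun i j =>
      ∫ x in face P M i j, cn P M c i x * pval (v i) x ∂(surf d),
    sum_filter_snd M.faces fun i j =>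
      ∫ x in face P M i j, cn P M c i x * pval (v i) x ∂(surf d)] at hvol
  have hinflow : ∑ i, inflowTerm P M c v i =
      ∑ e ∈ M.faces, (∫ x in face P M e.1 e.2 ∩ {x | un P M e.1 x < 0},
        pval (v e.1) x * (un P M e.1 x * (tr P M c e.1 x - tr P M c e.2 x)) ∂(surf d))
      + ∑ e ∈ M.faces, (∫ x in face P M e.2 e.1 ∩ {x | un P M e.2 x < 0},
        pval (v e.2) x * (un P M e.2 x * (tr P M c e.2 x - tr P M c e.1 x)) ∂(surf d))
      + ∑ i, ∫ x in bface P M i ∩ {x | un P M i x < 0},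
          pval (v i) x * (un P M i x * tr P M c i x) ∂(surf d) := by
    simp only [inflowTerm, Finset.sum_add_distrib]
    rw [sum_filter_fst M.faces fun i j => ∫ x in face P M i j ∩ {x | un P M i x < 0},
        pval (v i) x * (un P M i x * (tr P M c i x - tr P M c j x)) ∂(surf d),
      sum_filter_snd M.faces fun i j => ∫ x in face P M i j ∩ {x | un P M i x < 0},
        pval (v i) x * (un P M i x * (tr P M c i x - tr P M c j x)) ∂(surf d)]
  have hface := Finset.sum_congr (rfl : M.faces = M.faces) fun e he =>
    face_identity hd1 hdata hfaces hreg hc hdfdf haddf hadad v he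
  simp only [Finset.sum_add_distrib, ← Finset.sum_filter] at hface
  have hbface := Finset.sum_congr (rfl : (Finset.univ : Finset ι) = Finset.univ) fun i _ =>
    bface_identity hdata hreg hc i (v i)
  simp only [Finset.sum_add_distrib, Finset.sum_sub_distrib, Finset.sum_const_zero] at hbface
  rw [← sum_dirFaces_eq] at hbface
  have hdf : dfdfFaces P M = M.faces.filter fun e => IsDfDf P M e.1 e.2 := by
    rw [dfdfFaces]
  rw [Lform, Rform, hsymm, hpen, Sform_eq_Tform hdata hreg hc, hinflow]
  simp only [hdirF, hdirP, hdf]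
  linarith
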